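/- Let $f:\mathbb{R}^q\to\mathbb{R}\cup\{\pm\infty\}$ be quasi-concave, $A\in\mathbb{R}^{m\times n}$, $b\in\mathbb{R}^m$, $P\in\mathbb{R}^{q\times n}$, and let $S=\{x\in\mathbb{R}^n : Ax\ge b\}$ be nonempty. Consider $$\text{(QCP)}\qquad \min f(Px)\ \text{ s.t. }\ Ax\ge b .$$ Let $C=\{Y\mu : \mu\ge 0\}$, $Y\in\mathbb{R}^{q\times o}$, be a pointed polyhedral convex cone, possibly with empty interior, such that (M) $f$ is $C$-monotone on $P[S]-C$ (i.e. $x,y\in P[S]-C$ and $y-x\in C$ imply $f(x)\le f(y)$), and (B) $P[S]$ is $C$-bounded, i.e. $0^+P[S]\subseteq C$, where $0^+$ denotes the recession cone. With $e$ the all-ones vector, put $$\bar P=\begin{pmatrix}P\\-e^{\mathsf T}P\end{pmatrix},\qquad \bar Y=\left(I,\begin{matrix}Y\\-e^{\mathsf T}Y\end{matrix}\right),\qquad R=\{\bar Y\nu:\nu\ge0\}\subseteq\mathbb{R}^{q+1},$$ $$\bar f\binom{y}{\eta}=\begin{cases} f(y), & e^{\mathsf T}y+\eta\ge0,\\ -\infty,&\text{otherwise,}\end{cases}\qquad\quad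 \text{(QCP}'\text{)}\quad \min\bar f(\bar Px)\ \text{ s.t. }\ Ax\ge b .$$ Then: 1. $R$ is pointed and solid ($\operatorname{int}R\ne\emptyset$), $\bar f$ is quasi-concave, and (M) and (B) hold for (QCP$'$) with respect to $R$. 2. (QCP) and (QCP$'$) have the same optimal solutions. 3. The inputs needed below exist: there is a matrix $\bar Z$ with $R=\{y:\bar Z^{\mathsf T}y\ge0\}$, a vector $c\in\operatorname{int}R$ with $c_{q+1}=1$, and a polyhedron $\mathcal O\supseteq\bar P[S]+R$ with $0^+\mathcal O=R$. 4. For every matrix $\bar Z$ with $R=\{y:\bar Z^{\mathsf T}y\ge0\}$, every $c\in\operatorname{int}R$ and every polyhedron $\mathcal O\supseteq\bar P[S]+R$ with $0^+\mathcal O=R$, the primal algorithm below is correct and finite; if moreover $c_{q+1}=1$, the dual algorithm below is correct and finite. *Correct and finite* means: for all possible choices of minimizers and of optimal solutions of the linear programs, every instruction reached can be executed, no run is infinite, and the output $x$ is an optimal solution of (QCP$'$) and of (QCP). The linear programs involved are - $P_1(w)$: $\min w^{\mathsf T}\bar Px$ s.t. $Ax\ge b$; - $P_2(t)$: $\min z$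 s.t. $Ax\ge b$, $\bar Z^{\mathsf T}\bar Px\le\bar Z^{\mathsf T}t+z\,\bar Z^{\mathsf T}c$; - $D_2(t)$: $\max b^{\mathsf T}u-t^{\mathsf T}w$ s.t. $A^{\mathsf T}u=\bar P^{\mathsf T}w$, $c^{\mathsf T}w=1$, $\bar Y^{\mathsf T}w\ge0$, $u\ge0$. Further, for $y,y^*\in\mathbb{R}^{q+1}$, let $\omega(y^*)=(y^*_1,\dots,y^*_q,\,1-\sum_{i=1}^{q}c_iy^*_i)^{\mathsf T}$ and $\varphi(y,y^*)=\omega(y^*)^{\mathsf T}y-y^*_{q+1}$. *Primal algorithm* (Algorithm 2). Loop: choose a vertex $t$ of $\mathcal O$ minimizing $\bar f$ over the vertices of $\mathcal O$; compute optimal solutions $(x,z)$ of $P_2(t)$ and $(u,w)$ of $D_2(t)$; if $z>0$, replace $\mathcal O$ by $\mathcal O\cap\{y:w^{\mathsf T}y\ge b^{\mathsf T}u\}$; otherwise stop with output $x$. *Dual algorithm* (Algorithm 4). Initialize $\mathcal O^*=\{y^*:\bar y^{\mathsf T}\omega(y^*)\ge0\text{ for all columns }\bar y\text{ of }\bar Y\}$,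 $T^*=\emptyset$, $w=$ the sum of the columns of $\bar Z$, $t^*=(c^{\mathsf T}w)^{-1}w$, and then $t^*_{q+1}=\infty$. Loop: set $w=\omega(t^*)$ and compute an optimal solution $x$ of $P_1(w)$. If $t^*_{q+1}-w^{\mathsf T}\bar Px>0$, replace $\mathcal O^*$ by $\mathcal O^*\cap\{y^*:\varphi(\bar Px,y^*)\ge0\}$; otherwise add $t^*$ to $T^*$. Replace $\mathcal O$ by $\mathcal O\cap\{y:w^{\mathsf T}y\ge w^{\mathsf T}\bar Px\}$ and choose a vertex $t$ of $\mathcal O$ minimizing $\bar f$ over the vertices of $\mathcal O$. If the minimum of $\varphi(t,\cdot)$ over the vertices of $\mathcal O^*$ is negative, choose as the new $t^*$ a minimizer of $\varphi(t,\cdot)$ over the vertices of $\mathcal O^*$ not in $T^*$; otherwise determine $x\in S$ with $t=\bar Px$ and stop with output $x$. -/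

import Mathlib

open Matrix

/-! ### Polyhedra and cones in `ℝᵏ = (Fin k → ℝ)` -/

/-- A convex polyhedron: the solution set of finitely many affine inequalities (`G y ≥ g` is an
H-representation of `K`). -/
def IsPolyhedron {k : ℕ} (K : Set (Fin k → ℝ)) : Prop :=
  ∃ (r : ℕ) (G : Matrix (Fin r) (Fin k) ℝ) (g : Fin r → ℝ), K = {y | g ≤ G *ᵥ y}

/-- The recession cone `0⁺K`. -/
def recessionCone {k : ℕ} (K : Set (Fin k → ℝ)) : Set (Fin k → ℝ) :=
  {d | ∀ y ∈ K, ∀ s : ℝ, 0 ≤ s → y + s • d ∈ K}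

/-- The cone `{Y μ | μ ≥ 0}` generated by the columns of `Y`. -/
def generatedCone {k : ℕ} {ι : Type*} [Fintype ι] (Y : Matrix (Fin k) ι ℝ) : Set (Fin k → ℝ) :=
  {y | ∃ μ : ι → ℝ, 0 ≤ μ ∧ y = Y *ᵥ μ}

/-- The cone `{y | Zᵀ y ≥ 0}` described by the columns of `Z`. -/
def inequalityCone {k : ℕ} {κ : Type*} (Z : Matrix (Fin k) κ ℝ) : Set (Fin k → ℝ) :=
  {y | 0 ≤ Zᵀ *ᵥ y}

/-- Pointedness: `C ∩ (-C) = {0}`. -/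
def IsPointedCone {k : ℕ} (C : Set (Fin k → ℝ)) : Prop :=
  C ∩ {y | -y ∈ C} = {0}

/-- `g` is `C`-monotone on `D`: for `x, y ∈ D`, `x ≤_C y` implies `g x ≤ g y`. -/
def ConeMonotoneOn {k : ℕ} (C : Set (Fin k → ℝ)) (g : (Fin k → ℝ) → EReal)
    (D : Set (Fin k → ℝ)) : Prop :=
  ∀ x ∈ D, ∀ y ∈ D, y - x ∈ C → g x ≤ g y

/-! ### The problem `min f(Px)  s.t.  Ax ≥ b` -/

/-- The data of the problem `min f(Px) s.t. Ax ≥ b`. -/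
structure QCP (m n k : ℕ) where
  A : Matrix (Fin m) (Fin n) ℝ
  b : Fin m → ℝ
  P : Matrix (Fin k) (Fin n) ℝ
  f : (Fin k → ℝ) → EReal

namespace QCP

variable {m n k : ℕ} (p : QCP m n k)

/-- The feasible set `S`. -/
def feasible : Set (Fin n → ℝ) := {x | p.b ≤ p.A *ᵥ x}

/-- The image `P[S]`. -/
def image : Set (Fin k → ℝ) := {y | ∃ x ∈ p.feasible, y = p.P *ᵥ x}

/-- The upper image `P[S] + C` of the vector linear program `min_C Px s.t. Ax ≥ b`. -/
def upperImage (C : Set (Fin k → ℝ)) : Set (Fin k → ℝ) :=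
  {y | ∃ v ∈ p.image, ∃ d ∈ C, y = v + d}

/-- `x` is an optimal solution of `min f(Px) s.t. Ax ≥ b`. -/
def IsOptimal (x : Fin n → ℝ) : Prop :=
  x ∈ p.feasible ∧ ∀ v ∈ p.feasible, p.f (p.P *ᵥ x) ≤ p.f (p.P *ᵥ v)

/-- Monotonicity assumption: `f` is `C`-monotone on `P[S] - C`. -/
def AssumptionM (C : Set (Fin k → ℝ)) : Prop :=
  ConeMonotoneOn C p.f {y | ∃ v ∈ p.image, ∃ d ∈ C, y = v - d}

/-- Boundedness assumption: `P[S]` is `C`-bounded. -/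
def AssumptionB (C : Set (Fin k → ℝ)) : Prop :=
  recessionCone p.image ⊆ C

/-- `O` is an admissible initial outer approximation: a polyhedron containing the upper image,
with recession cone `C`. -/
def AssumptionO (C O : Set (Fin k → ℝ)) : Prop :=
  IsPolyhedron O ∧ p.upperImage C ⊆ O ∧ recessionCone O = C

/-! ### The scalar linear programs -/

/-- `x` is an optimal solution of `P₁(w)`: `min wᵀPx s.t. Ax ≥ b`. -/
def IsOptimalP1 (w : Fin k → ℝ) (x : Fin n → ℝ) : Prop :=
  x ∈ p.feasible ∧ ∀ v ∈ p.feasible, w ⬝ᵥ (p.P *ᵥ x) ≤ w ⬝ᵥ (p.P *ᵥ v)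

/-- Feasibility for `P₂(t)`: `Ax ≥ b`, `ZᵀPx ≤ Zᵀt + z Zᵀc`. -/
def FeasibleP2 {κ : Type*} (Z : Matrix (Fin k) κ ℝ) (c t : Fin k → ℝ)
    (x : Fin n → ℝ) (z : ℝ) : Prop :=
  p.b ≤ p.A *ᵥ x ∧ Zᵀ *ᵥ (p.P *ᵥ x) ≤ Zᵀ *ᵥ t + z • (Zᵀ *ᵥ c)

/-- `(x, z)` is an optimal solution of `P₂(t)`: minimize `z`. -/
def IsOptimalP2 {κ : Type*} (Z : Matrix (Fin k) κ ℝ) (c t : Fin k → ℝ)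
    (x : Fin n → ℝ) (z : ℝ) : Prop :=
  p.FeasibleP2 Z c t x z ∧ ∀ x' z', p.FeasibleP2 Z c t x' z' → z ≤ z'

/-- Feasibility for `D₂(t)`: `Aᵀu = Pᵀw`, `cᵀw = 1`, `Yᵀw ≥ 0`, `u ≥ 0`. -/
def FeasibleD2 {ι : Type*} (Y : Matrix (Fin k) ι ℝ) (c : Fin k → ℝ)
    (u : Fin m → ℝ) (w : Fin k → ℝ) : Prop :=
  p.Aᵀ *ᵥ u = p.Pᵀ *ᵥ w ∧ c ⬝ᵥ w = 1 ∧ 0 ≤ Yᵀ *ᵥ w ∧ 0 ≤ u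

/-- `(u, w)` is an optimal solution of `D₂(t)`: maximize `bᵀu - tᵀw`. -/
def IsOptimalD2 {ι : Type*} (Y : Matrix (Fin k) ι ℝ) (c t : Fin k → ℝ)
    (u : Fin m → ℝ) (w : Fin k → ℝ) : Prop :=
  p.FeasibleD2 Y c u w ∧
    ∀ u' w', p.FeasibleD2 Y c u' w' → p.b ⬝ᵥ u' - t ⬝ᵥ w' ≤ p.b ⬝ᵥ u - t ⬝ᵥ w

end QCP

/-! ### Algorithms as nondeterministic transition systems -/

/-- An algorithm, given by its one-instruction transition relation `step`, its initial
configuration `start` and its halting configurations `halt x` (with output `x`), is correct and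
finite with respect to the specification `Spec`, whatever choices are made (selection of
minimizers, solutions returned by the LP solver):
* it never gets stuck, i.e. every instruction that is reached can be executed;
* no run is infinite;
* every output meets the specification. -/
def CorrectAndFinite {σ α : Type*} (step : σ → σ → Prop) (start : σ) (halt : α → σ)
    (Spec : α → Prop) : Prop :=
  (∀ s, Relation.ReflTransGen step start s → (∃ x, s = halt x) ∨ ∃ s', step s s') ∧
  (¬ ∃ run : ℕ → σ, run 0 = start ∧ ∀ i, step (run i) (run (i + 1))) ∧
  (∀ x, Relation.ReflTransGen step start (halt x) → Spec x)

/-- Configurations of the primal algorithm. -/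
inductive PrimalState (m n k : ℕ) : Type
  /-- head of the loop, with current outer approximation `O` -/
  | loop (O : Set (Fin k → ℝ))
  /-- a vertex `t` of `O` has been chosen -/
  | chosen (O : Set (Fin k → ℝ)) (t : Fin k → ℝ)
  /-- the linear programs `P₂(t)` / `D₂(t)` have been solved -/
  | solved (O : Set (Fin k → ℝ)) (x : Fin n → ℝ) (z : ℝ) (u : Fin m → ℝ) (w : Fin k → ℝ)
  /-- termination with output `x` -/
  | halt (x : Fin n → ℝ)

/-- The modified primal Benson-type algorithm. Input: the problem `p`, matrices `Y`, `Z` with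
`C = {Y μ | μ ≥ 0} = {y | Zᵀ y ≥ 0}`, the vector `c ∈ int C`; the outer approximation is part of
the configuration. -/
inductive PrimalStep {m n k : ℕ} {ι κ : Type*} (p : QCP m n k)
    (Y : Matrix (Fin k) ι ℝ) (Z : Matrix (Fin k) κ ℝ) (c : Fin k → ℝ) :
    PrimalState m n k → PrimalState m n k → Prop
  /-- compute the finite set `V` of vertices of `O` and choose `t ∈ argmin {f(t) | t ∈ V}` -/
  | choose (O : Set (Fin k → ℝ)) (V : Finset (Fin k → ℝ)) (t : Fin k → ℝ)
      (hV : (V : Set (Fin k → ℝ)) = Set.extremePoints ℝ O)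
      (ht : t ∈ V) (hmin : ∀ s ∈ V, p.f t ≤ p.f s) :
      PrimalStep p Y Z c (.loop O) (.chosen O t)
  /-- `(x, z, u, w) ← solve(P₂(t)/D₂(t))` -/
  | solve (O : Set (Fin k → ℝ)) (t : Fin k → ℝ)
      (x : Fin n → ℝ) (z : ℝ) (u : Fin m → ℝ) (w : Fin k → ℝ)
      (hP : p.IsOptimalP2 Z c t x z) (hD : p.IsOptimalD2 Y c t u w) :
      PrimalStep p Y Z c (.chosen O t) (.solved O x z u w)
  /-- if `z > 0` then `O ← O ∩ {y | wᵀy ≥ bᵀu}` -/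
  | cut (O : Set (Fin k → ℝ)) (x : Fin n → ℝ) (z : ℝ) (u : Fin m → ℝ) (w : Fin k → ℝ)
      (hz : 0 < z) :
      PrimalStep p Y Z c (.solved O x z u w) (.loop (O ∩ {y | p.b ⬝ᵥ u ≤ w ⬝ᵥ y}))
  /-- else break -/
  | finish (O : Set (Fin k → ℝ)) (x : Fin n → ℝ) (z : ℝ) (u : Fin m → ℝ) (w : Fin k → ℝ)
      (hz : ¬ 0 < z) :
      PrimalStep p Y Z c (.solved O x z u w) (.halt x)

/-- `ω(t*) = (t*₁, …, t*_d, 1 - ∑ᵢ cᵢ t*ᵢ)`, which depends on the first `d` components `a` of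
`t* ∈ ℝ^{d+1}` only. -/
def omegaVec {d : ℕ} (c : Fin (d + 1) → ℝ) (a : Fin d → ℝ) : Fin (d + 1) → ℝ :=
  Fin.snoc (α := fun _ => ℝ) a (1 - ∑ i : Fin d, c i.castSucc * a i)

/-- The coupling function
`φ(y, y*) = ∑_{i ≤ d} yᵢ y*ᵢ + y_{d+1} (1 - ∑_{i ≤ d} cᵢ y*ᵢ) - y*_{d+1}`. -/
def coupling {d : ℕ} (c y ystar : Fin (d + 1) → ℝ) : ℝ :=
  (∑ i : Fin d, y i.castSucc * ystar i.castSucc)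
    + y (Fin.last d) * (1 - ∑ i : Fin d, c i.castSucc * ystar i.castSucc)
    - ystar (Fin.last d)

/-- Configurations of the dual algorithm. `Os`, `Ts`, `O` stand for `𝒪*`, `T*`, `𝒪`. The current
point `t*`, whose last component is `∞` at the beginning, is stored as the pair of its first `d`
components `a` and its last component `τ`. -/
inductive DualState (n d : ℕ) : Type
  /-- before the initialization, with the given outer approximation `O` -/
  | start (O : Set (Fin (d + 1) → ℝ))
  /-- head of the loop -/
  | loop (Os Ts O : Set (Fin (d + 1) → ℝ)) (a : Fin d → ℝ) (τ : WithTop ℝ)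
  /-- the linear program `P₁(ω(t*))` has been solved, with solution `x` -/
  | solved (Os Ts O : Set (Fin (d + 1) → ℝ)) (a : Fin d → ℝ) (τ : WithTop ℝ) (x : Fin n → ℝ)
  /-- the outer approximations have been updated -/
  | updated (Os Ts O : Set (Fin (d + 1) → ℝ))
  /-- a vertex `t` of `O` has been chosen -/
  | chosen (Os Ts O : Set (Fin (d + 1) → ℝ)) (t : Fin (d + 1) → ℝ)
  /-- termination with output `x` -/
  | halt (x : Fin n → ℝ)

/-- The modified dual variant of Benson's algorithm. Input: the problem `p`, matrices `Y`, `Z`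
with `C = {Y μ | μ ≥ 0} = {y | Zᵀ y ≥ 0}`, the vector `c ∈ int C` with last component `1`, and the
outer approximation in the configuration `start`. -/
inductive DualStep {m n d : ℕ} {ι κ : Type*} [Fintype κ] (p : QCP m n (d + 1))
    (Y : Matrix (Fin (d + 1)) ι ℝ) (Z : Matrix (Fin (d + 1)) κ ℝ) (c : Fin (d + 1) → ℝ) :
    DualState n d → DualState n d → Prop
  /-- `𝒪* ← {y* | yᵀω(y*) ≥ 0 for the columns y of Y}`, `T* ← ∅`, `w ← ` sum of the columns of
  `Z`, `t* ← (cᵀw)⁻¹ w` (which requires `cᵀw ≠ 0`), `t*_{d+1} ← ∞` -/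
  | setup (O : Set (Fin (d + 1) → ℝ)) (w : Fin (d + 1) → ℝ)
      (hw : w = ∑ j, Zᵀ j) (hcw : c ⬝ᵥ w ≠ 0) :
      DualStep p Y Z c (.start O)
        (.loop {ys | ∀ j, 0 ≤ Yᵀ j ⬝ᵥ omegaVec c (fun i => ys i.castSucc)} ∅ O
          (fun i => (c ⬝ᵥ w)⁻¹ * w i.castSucc) ⊤)
  /-- `w ← ω(t*)`, `x ← solve(P₁(w))` -/
  | solve (Os Ts O : Set (Fin (d + 1) → ℝ)) (a : Fin d → ℝ) (τ : WithTop ℝ) (x : Fin n → ℝ)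
      (hx : p.IsOptimalP1 (omegaVec c a) x) :
      DualStep p Y Z c (.loop Os Ts O a τ) (.solved Os Ts O a τ x)
  /-- if `t*_{d+1} - wᵀPx > 0`, then `𝒪* ← 𝒪* ∩ {y* | φ(Px, y*) ≥ 0}`; in any case
  `𝒪 ← 𝒪 ∩ {y | wᵀy ≥ wᵀPx}` -/
  | cut (Os Ts O : Set (Fin (d + 1) → ℝ)) (a : Fin d → ℝ) (τ : WithTop ℝ) (x : Fin n → ℝ)
      (hτ : ((omegaVec c a ⬝ᵥ (p.P *ᵥ x) : ℝ) : WithTop ℝ) < τ) :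
      DualStep p Y Z c (.solved Os Ts O a τ x)
        (.updated (Os ∩ {ys | 0 ≤ coupling c (p.P *ᵥ x) ys}) Ts
          (O ∩ {y | omegaVec c a ⬝ᵥ (p.P *ᵥ x) ≤ omegaVec c a ⬝ᵥ y}))
  /-- else `T* ← T* ∪ {t*}`; in any case `𝒪 ← 𝒪 ∩ {y | wᵀy ≥ wᵀPx}` -/
  | mark (Os Ts O : Set (Fin (d + 1) → ℝ)) (a : Fin d → ℝ) (τ : ℝ) (x : Fin n → ℝ)
      (hτ : τ ≤ omegaVec c a ⬝ᵥ (p.P *ᵥ x)) :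
      DualStep p Y Z c (.solved Os Ts O a (τ : WithTop ℝ) x)
        (.updated Os (Ts ∪ {Fin.snoc (α := fun _ => ℝ) a τ})
          (O ∩ {y | omegaVec c a ⬝ᵥ (p.P *ᵥ x) ≤ omegaVec c a ⬝ᵥ y}))
  /-- compute the finite set `V` of vertices of `𝒪` and choose `t ∈ argmin {f(y) | y ∈ V}` -/
  | choose (Os Ts O : Set (Fin (d + 1) → ℝ)) (V : Finset (Fin (d + 1) → ℝ))
      (t : Fin (d + 1) → ℝ)
      (hV : (V : Set (Fin (d + 1) → ℝ)) = Set.extremePoints ℝ O)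
      (ht : t ∈ V) (hmin : ∀ s ∈ V, p.f t ≤ p.f s) :
      DualStep p Y Z c (.updated Os Ts O) (.chosen Os Ts O t)
  /-- with `Vs` the finite set of vertices of `𝒪*`: if `min {φ(t, y*) | y* ∈ Vs} < 0`, then choose
  `t* ∈ argmin {φ(t, y*) | y* ∈ Vs ∖ T*}` -/
  | next (Os Ts O : Set (Fin (d + 1) → ℝ)) (t : Fin (d + 1) → ℝ)
      (Vs : Finset (Fin (d + 1) → ℝ)) (μ : ℝ) (tstar : Fin (d + 1) → ℝ)
      (hVs : (Vs : Set (Fin (d + 1) → ℝ)) = Set.extremePoints ℝ Os)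
      (hμ : IsLeast {r | ∃ ys ∈ Vs, r = coupling c t ys} μ) (hneg : μ < 0)
      (hmem : tstar ∈ Vs) (hnew : tstar ∉ Ts)
      (hmin : ∀ ys ∈ Vs, ys ∉ Ts → coupling c t tstar ≤ coupling c t ys) :
      DualStep p Y Z c (.chosen Os Ts O t)
        (.loop Os Ts O (fun i => tstar i.castSucc) (tstar (Fin.last d) : ℝ))
  /-- else determine `x ∈ S` such that `t = Px` and break -/
  | finish (Os Ts O : Set (Fin (d + 1) → ℝ)) (t : Fin (d + 1) → ℝ)
      (Vs : Finset (Fin (d + 1) → ℝ)) (μ : ℝ) (x : Fin n → ℝ)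
      (hVs : (Vs : Set (Fin (d + 1) → ℝ)) = Set.extremePoints ℝ Os)
      (hμ : IsLeast {r | ∃ ys ∈ Vs, r = coupling c t ys} μ) (hnonneg : ¬ μ < 0)
      (hx : x ∈ p.feasible) (hxt : t = p.P *ᵥ x) :
      DualStep p Y Z c (.chosen Os Ts O t) (.halt x)

/-! ### The reformulated problem -/

/-- The matrix `(M; -eᵀM)` obtained by appending the negative of the sum of the rows of `M`. -/
def appendNegRowSum {q : ℕ} {ι : Type*} (M : Matrix (Fin q) ι ℝ) : Matrix (Fin (q + 1)) ι ℝ :=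
  Matrix.of fun i j => Fin.snoc (α := fun _ => ℝ) (fun i => M i j) (-∑ i, M i j) i

/-- The matrix `(I, (Y; -eᵀY))`, whose columns generate the cone `R`. -/
def extendedGenerators {q o : ℕ} (Y : Matrix (Fin q) (Fin o) ℝ) :
    Matrix (Fin (q + 1)) (Fin (q + 1) ⊕ Fin o) ℝ :=
  Matrix.fromCols 1 (appendNegRowSum Y)

open Classical in
/-- `f̄(y, η) = f(y)` if `eᵀy + η ≥ 0`, and `-∞` otherwise. -/
noncomputable def extendedObjective {q : ℕ} (f : (Fin q → ℝ) → EReal) :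
    (Fin (q + 1) → ℝ) → EReal :=
  fun y => if 0 ≤ (∑ i : Fin q, y i.castSucc) + y (Fin.last q) then f (fun i => y i.castSucc) else ⊥

/-- The reformulated problem `min f̄(P̄x) s.t. Ax ≥ b`. -/
noncomputable def QCP.reformulated {m n q : ℕ} (p : QCP m n q) : QCP m n (q + 1) where
  A := p.A
  b := p.b
  P := appendNegRowSum p.P
  f := extendedObjective p.f

/-! The reformulation is governed by one functional, `coordSum`, sending (y, η) to eᵀy + η. It is
nonnegative on `R`, zero on the image P̄[S], and the face of `R` on which it vanishes is a copy of
`C`. On P̄[S] - R it is at most zero, so f̄ is -∞ there except on the hyperplane `coordSum = 0`,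
where monotonicity reduces to that of `f` with respect to `C`. The identity columns make `R` solid
and, since they have positive `coordSum`, leave it pointed.

Correctness of both algorithms rests on two facts about an outer approximation `O` of P[S] + R whose
recession cone is the pointed cone `R`. Such an `O` is contained in the convex hull of its vertices
plus `R`, so for a quasi-concave monotone objective the least value at a vertex is a lower bound for
the problem (`le_of_minimal_vertex`). A vertex of `O` that lies in P[S] + R already lies in P[S]
(`eq_image_of_vertex`), so the bound is attained when the algorithms stop. That every instruction
can be executed follows from strong linear programming duality (`exists_linearProgram_solution`),
proved from Weyl's theorem by Fourier-Motzkin elimination.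

Solutions of the linear programs need not be vertices, so finiteness cannot count cuts directly.
Instead cuts are classified by finite combinatorial data: the supports of u and Yᵀw in the primal
algorithm, the active constraints of x in the dual one. By complementary slackness, cuts with equal
data are tight at the same places, so a cut that separates a point of the current set has data not
yet realized by a valid cut. Between two cuts of 𝒪*, the dual algorithm only marks vertices,
finitely many, and never selects a marked vertex again. A lexicographic rank combines these counts.
-/

/-! ### Farkas' lemma and linear programming duality. -/

section Farkas

variable {E ι : Type*} [AddCommGroup E] [Module ℝ E]

/-- Eliminating the multiplier `s` from `y - s • v ∈ K`, where `K` is a polyhedral cone. -/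
theorem exists_functionals_add_ray (S : Finset (E →ₗ[ℝ] ℝ)) (v : E) :
    ∃ T : Finset (E →ₗ[ℝ] ℝ), ∀ y : E,
      (∃ s : ℝ, 0 ≤ s ∧ ∀ l ∈ S, 0 ≤ l (y - s • v)) ↔ ∀ l ∈ T, 0 ≤ l y := by
  classical
  -- Fourier-Motzkin elimination: a functional with `l v < 0` bounds `s` from below, one with `0 < l
  -- v` bounds it from above, and each such pair is combined into a functional vanishing at `v`.
  refine ⟨S.filter (fun l => 0 ≤ l v) ∪
    ((S.filter fun l => l v < 0) ×ˢ (S.filter fun l => 0 < l v)).image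
      (fun q => q.2 v • q.1 - q.1 v • q.2), fun y => ?_⟩
  simp only [Finset.mem_union, Finset.mem_filter, Finset.mem_image, Finset.mem_product, map_sub,
    map_smul, smul_eq_mul]
  constructor
  · rintro ⟨s, hs, h⟩ l (⟨hl, hv⟩ | ⟨⟨l₁, l₂⟩, ⟨⟨h₁, hv₁⟩, h₂, hv₂⟩, rfl⟩)
    · nlinarith [h l hl, mul_nonneg hs hv]
    · have a := h l₁ h₁
      have b := h l₂ h₂
      simp only [LinearMap.sub_apply, LinearMap.smul_apply, smul_eq_mul]
      simp only at hv₁ hv₂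
      nlinarith [mul_nonneg hv₂.le a, mul_nonneg (neg_nonneg.2 hv₁.le) b]
  · intro h
    have hnn : ∀ l ∈ S, 0 ≤ l v → 0 ≤ l y := fun l hl hv => h l (Or.inl ⟨hl, hv⟩)
    have hpair : ∀ l₁ ∈ S, ∀ l₂ ∈ S, l₁ v < 0 → 0 < l₂ v → 0 ≤ l₂ v * l₁ y - l₁ v * l₂ y := by
      intro l₁ h₁ l₂ h₂ hv₁ hv₂
      simpa using h _ (Or.inr ⟨(l₁, l₂), ⟨⟨h₁, hv₁⟩, h₂, hv₂⟩, rfl⟩)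
    by_cases hne : (S.filter fun l => 0 < l v).Nonempty
    · obtain ⟨l₂, hl₂, hmin⟩ := Finset.exists_min_image _ (fun l => l y / l v) hne
      simp only [Finset.mem_filter] at hl₂ hmin
      refine ⟨l₂ y / l₂ v, div_nonneg (hnn l₂ hl₂.1 hl₂.2.le) hl₂.2.le, fun l hl => ?_⟩
      rcases lt_trichotomy (l v) 0 with hv | hv | hv
      · have := hpair l hl l₂ hl₂.1 hv hl₂.2
        have e : l y - l₂ y / l₂ v * l v = (l₂ v * l y - l v * l₂ y) / l₂ v := by
          field_simp [hl₂.2.ne']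
        rw [e]
        exact div_nonneg this hl₂.2.le
      · simpa [hv] using hnn l hl hv.ge
      · have := mul_le_mul_of_nonneg_right (hmin l ⟨hl, hv⟩) hv.le
        rw [div_mul_cancel₀ _ hv.ne'] at this
        linarith
    · have hle : ∀ l ∈ S, l v ≤ 0 := fun l hl => not_lt.1 fun hv =>
        hne ⟨l, Finset.mem_filter.2 ⟨hl, hv⟩⟩
      -- No functional bounds `s` from above, so any number dominating all the lower bounds `l y / l
      -- v` will do.
      refine ⟨∑ l ∈ S, |l y / l v|, Finset.sum_nonneg fun _ _ => abs_nonneg _, fun l hl => ?_⟩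
      rcases (hle l hl).lt_or_eq with hv | hv
      · have h1 : |l y / l v| ≤ ∑ l ∈ S, |l y / l v| :=
          Finset.single_le_sum (f := fun l => |l y / l v|) (fun _ _ => abs_nonneg _) hl
        have h2 : l y / l v * l v = l y := div_mul_cancel₀ _ hv.ne
        nlinarith [mul_le_mul_of_nonpos_right ((le_abs_self _).trans h1) hv.le]
      · simpa [hv] using hnn l hl hv.ge

/-- Weyl's theorem: a finitely generated cone is cut out by finitely many linear functionals. -/
theorem exists_functionals_of_fg [FiniteDimensional ℝ E] (v : ι → E) (s : Finset ι) :
    ∃ T : Finset (E →ₗ[ℝ] ℝ), ∀ y : E,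
      (∃ c : ι → ℝ, 0 ≤ c ∧ ∑ i ∈ s, c i • v i = y) ↔ ∀ l ∈ T, 0 ≤ l y := by
  classical
  induction s using Finset.induction_on with
  | empty =>
    let B := Module.finBasis ℝ E
    refine ⟨Finset.univ.image (fun i => B.coord i) ∪ Finset.univ.image (fun i => -B.coord i),
      fun y => ⟨?_, fun h => ⟨0, le_rfl, ?_⟩⟩⟩
    · rintro ⟨c, -, rfl⟩ l -
      simp
    · rw [Finset.sum_empty]
      refine (B.ext_elem fun i => ?_).symm
      have h1 := h (B.coord i) (Finset.mem_union_left _ (Finset.mem_image_of_mem _ (by simp)))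
      have h2 := h (-B.coord i) (Finset.mem_union_right _
        (Finset.mem_image.2 ⟨i, by simp, rfl⟩))
      simp only [LinearMap.neg_apply, Module.Basis.coord_apply] at h1 h2
      simp only [map_zero, Finsupp.coe_zero, Pi.zero_apply]
      linarith
  | insert a s ha ih =>
    obtain ⟨T, hT⟩ := ih
    obtain ⟨T', hT'⟩ := exists_functionals_add_ray T (v a)
    refine ⟨T', fun y => (Iff.trans ?_ (hT' y))⟩
    constructor
    · rintro ⟨c, hc, rfl⟩
      refine ⟨c a, hc a, (hT _).1 ⟨c, hc, ?_⟩⟩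
      rw [Finset.sum_insert ha, add_sub_cancel_left]
    · rintro ⟨r, hr, h⟩
      obtain ⟨c, hc, hy⟩ := (hT _).2 h
      refine ⟨Function.update c a r, ?_, ?_⟩
      · intro i
        by_cases hi : i = a
        · subst hi; simpa using hr
        · simpa [hi] using hc i
      · rw [Finset.sum_insert ha, Function.update_self,
          Finset.sum_congr rfl fun i hi => by
            rw [Function.update_of_ne (ne_of_mem_of_not_mem hi ha)], hy]
        abel

/-- Farkas' lemma for finitely many functionals. -/
theorem exists_nonneg_combination [FiniteDimensional ℝ E] [Fintype ι] (l : ι → E →ₗ[ℝ] ℝ)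
    (f : E →ₗ[ℝ] ℝ) (h : ∀ x, (∀ i, 0 ≤ l i x) → 0 ≤ f x) :
    ∃ u : ι → ℝ, 0 ≤ u ∧ ∑ i, u i • l i = f := by
  classical
  -- Weyl's theorem is applied in the dual space; by reflexivity the functionals cutting out the
  -- cone of the `l i` are evaluations at points of `E`.
  obtain ⟨T, hT⟩ := exists_functionals_of_fg l Finset.univ
  refine (hT f).2 fun F hF => ?_
  obtain ⟨x, rfl⟩ := (Module.evalEquiv ℝ E).surjective F
  have : ∀ i, 0 ≤ l i x := fun i =>
    (hT (l i)).1 ⟨Pi.single i 1, fun j => by by_cases hj : j = i <;> simp [hj], by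
      simp [Pi.single_apply]⟩ _ hF
  exact h x this

/-- The affine Farkas lemma; `h0` is implied by `h` unless the system is infeasible. -/
theorem exists_nonneg_combination_affine [FiniteDimensional ℝ E] [Fintype ι]
    (l : ι → E →ₗ[ℝ] ℝ) (g : ι → ℝ) (f : E →ₗ[ℝ] ℝ) (β : ℝ)
    (h : ∀ x, (∀ i, g i ≤ l i x) → β ≤ f x) (h0 : ∀ x, (∀ i, 0 ≤ l i x) → 0 ≤ f x) :
    ∃ u : ι → ℝ, 0 ≤ u ∧ ∑ i, u i • l i = f ∧ β ≤ ∑ i, u i * g i := by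
  -- Homogenization: the extra coordinate `s ≥ 0` multiplies the right-hand sides. The slice `s > 0`
  -- rescales to `h`, the slice `s = 0` is `h0`.
  let l' : Option ι → (E × ℝ) →ₗ[ℝ] ℝ := fun o => o.elim (LinearMap.snd ℝ E ℝ)
    fun i => (l i).comp (LinearMap.fst ℝ E ℝ) - g i • LinearMap.snd ℝ E ℝ
  obtain ⟨u, hu, he⟩ := exists_nonneg_combination l'
    (f.comp (LinearMap.fst ℝ E ℝ) - β • LinearMap.snd ℝ E ℝ) (by
      rintro ⟨x, s⟩ hx
      have hs : 0 ≤ s := by simpa [l'] using hx none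
      have hi : ∀ i, g i * s ≤ l i x := fun i => by simpa [l'] using hx (some i)
      simp only [LinearMap.sub_apply, LinearMap.comp_apply, LinearMap.fst_apply,
        LinearMap.smul_apply, LinearMap.snd_apply, smul_eq_mul, sub_nonneg]
      rcases hs.eq_or_lt with rfl | hs
      · simpa using h0 x fun i => by simpa using hi i
      · have := h (s⁻¹ • x) fun i => by
          rw [map_smul, smul_eq_mul, le_inv_mul_iff₀ hs, mul_comm]; exact hi i
        rwa [map_smul, smul_eq_mul, le_inv_mul_iff₀ hs, mul_comm] at this)
  refine ⟨fun i => u (some i), fun i => hu _, ?_, ?_⟩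
  · ext x
    have := LinearMap.congr_fun he (x, 0)
    simpa [l', Fintype.sum_option, LinearMap.sum_apply] using this
  · have := LinearMap.congr_fun he (0, 1)
    simp [l', Fintype.sum_option, LinearMap.sum_apply] at this
    have h1 : 0 ≤ u none := hu none
    linarith

/-- Strong duality: a feasible linear program whose objective is nonnegative on the recession cone
has a primal-dual pair of optimal solutions. -/
theorem exists_linearProgram_solution [FiniteDimensional ℝ E] [Fintype ι]
    (l : ι → E →ₗ[ℝ] ℝ) (g : ι → ℝ) (f : E →ₗ[ℝ] ℝ)
    (hfeas : ∃ x, ∀ i, g i ≤ l i x) (h0 : ∀ x, (∀ i, 0 ≤ l i x) → 0 ≤ f x) :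
    ∃ (x : E) (u : ι → ℝ), (∀ i, g i ≤ l i x) ∧ 0 ≤ u ∧ ∑ i, u i • l i = f ∧
      f x = ∑ i, u i * g i := by
  have weak : ∀ (v : ι → ℝ) (x : E), 0 ≤ v → (∀ i, g i ≤ l i x) →
      ∑ i, v i * g i ≤ (∑ i, v i • l i) x := by
    intro v x hv hx
    simp only [LinearMap.sum_apply, LinearMap.smul_apply, smul_eq_mul]
    exact Finset.sum_le_sum fun i _ => mul_le_mul_of_nonneg_left (hx i) (hv i)
  obtain ⟨u₀, hu₀, he₀⟩ := exists_nonneg_combination l f h0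
  set V : Set ℝ := {r | ∃ x, (∀ i, g i ≤ l i x) ∧ r = f x} with hV
  have hVne : V.Nonempty := hfeas.imp' f fun x hx => ⟨x, hx, rfl⟩
  have hVbd : BddBelow V := by
    refine ⟨∑ i, u₀ i * g i, ?_⟩
    rintro _ ⟨x, hx, rfl⟩
    exact he₀ ▸ weak u₀ x hu₀ hx
  have hle : ∀ x, (∀ i, g i ≤ l i x) → sInf V ≤ f x := fun x hx => csInf_le hVbd ⟨x, hx, rfl⟩
  obtain ⟨x, hx, hxle⟩ : ∃ x, (∀ i, g i ≤ l i x) ∧ f x ≤ sInf V := by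
    by_contra hcon
    push Not at hcon
    -- If the infimum is not attained, adding the constraint `f x ≤ sInf V` is infeasible, and
    -- Farkas yields a certificate of `0 ≥ 1`. It keeps `v none * (f x - sInf V)` at least 1 on the
    -- feasible set, against the choice of an almost optimal `x`.
    obtain ⟨v, hv, hve, hv1⟩ := exists_nonneg_combination_affine
      (fun o : Option ι => o.elim (-f) l) (fun o => o.elim (-sInf V) g) 0 1 (by
        intro x hx
        have := hcon x fun i => hx (some i)
        have h2 := hx none
        simp only [Option.elim, LinearMap.neg_apply] at h2
        linarith) (by simp)
    simp only [Fintype.sum_option, Option.elim] at hve hv1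
    have hv0 : 0 ≤ v none := hv none
    have key : ∀ x, (∀ i, g i ≤ l i x) → 1 + v none * sInf V ≤ v none * f x := by
      intro x hx
      have h1 := weak (fun i => v (some i)) x (fun i => hv _) hx
      have h2 := LinearMap.congr_fun hve x
      simp only [LinearMap.add_apply, LinearMap.smul_apply, LinearMap.neg_apply, smul_eq_mul,
        LinearMap.zero_apply] at h2
      linarith
    -- The added 1 covers `v none = 0`, and makes `v none` times the tolerance less than 1.
    have hpos : 0 < 1 / (v none + 1) := by positivity
    obtain ⟨_, ⟨x, hx, rfl⟩, hlt⟩ := exists_lt_of_csInf_lt hVne (lt_add_of_pos_right (sInf V) hpos)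
    have h1 := key x hx
    have h2 := mul_le_mul_of_nonneg_left hlt.le hv0
    have h3 : v none * (1 / (v none + 1)) < 1 := by
      rw [mul_one_div, div_lt_one (by positivity)]; linarith
    linarith
  obtain ⟨u, hu, hue, hub⟩ := exists_nonneg_combination_affine l g f (sInf V) hle h0
  refine ⟨x, u, hx, hu, hue, le_antisymm (hxle.trans hub) ?_⟩
  exact hue ▸ weak u x hu hx

end Farkas

/-! ### Polyhedra, vertices and recession directions. -/

section Polyhedra

variable {E : Type*} [AddCommGroup E] [Module ℝ E]

/-- The polyhedron given by finitely many affine inequalities `β ≤ l y`. -/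
def halfspaceInter (S : Finset ((E →ₗ[ℝ] ℝ) × ℝ)) : Set E := {y | ∀ h ∈ S, h.2 ≤ h.1 y}

variable {S : Finset ((E →ₗ[ℝ] ℝ) × ℝ)}

theorem exists_pos_step_mem {y d : E} (hy : y ∈ halfspaceInter S)
    (hd : ∀ h ∈ S, h.1 y = h.2 → 0 ≤ h.1 d) : ∃ ε : ℝ, 0 < ε ∧ y + ε • d ∈ halfspaceInter S := by
  have : ∀ᶠ ε : ℝ in nhdsWithin 0 (Set.Ioi 0), ∀ h ∈ S, h.2 ≤ h.1 (y + ε • d) := by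
    rw [Finset.eventually_all]
    intro h hh
    simp only [map_add, map_smul, smul_eq_mul]
    rcases (hy h hh).eq_or_lt with he | hlt
    · filter_upwards [self_mem_nhdsWithin] with ε hε
      have := mul_nonneg (le_of_lt hε) (hd h hh he.symm)
      linarith
    · have hc : Filter.Tendsto (fun ε : ℝ => h.1 y + ε * h.1 d) (nhdsWithin 0 (Set.Ioi 0))
          (nhds (h.1 y)) := by
        have : Continuous fun ε : ℝ => h.1 y + ε * h.1 d := by fun_prop
        simpa using (this.tendsto 0).mono_left nhdsWithin_le_nhds
      exact (hc.eventually (lt_mem_nhds hlt)).mono fun ε h => h.le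
  obtain ⟨ε, h, hε⟩ := (this.and self_mem_nhdsWithin).exists
  exact ⟨ε, hε, h⟩

/-- Moving from `y` along `d` until a constraint becomes active. -/
theorem exists_max_step_mem {y d : E} (hy : y ∈ halfspaceInter S) (hd : ∃ h ∈ S, h.1 d < 0) :
    ∃ r : ℝ, 0 ≤ r ∧ y + r • d ∈ halfspaceInter S ∧
      ∃ h ∈ S, h.1 d < 0 ∧ h.1 (y + r • d) = h.2 := by
  classical
  obtain ⟨h₀, hh₀, hd₀⟩ := hd
  obtain ⟨h, hh, hmin⟩ := Finset.exists_min_image (S.filter fun h => h.1 d < 0)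
    (fun h => (h.2 - h.1 y) / h.1 d) ⟨h₀, Finset.mem_filter.2 ⟨hh₀, hd₀⟩⟩
  simp only [Finset.mem_filter] at hh hmin
  have hr : 0 ≤ (h.2 - h.1 y) / h.1 d :=
    div_nonneg_of_nonpos (sub_nonpos.2 (hy h hh.1)) hh.2.le
  refine ⟨_, hr, fun k hk => ?_, h, hh.1, hh.2, ?_⟩
  · simp only [map_add, map_smul, smul_eq_mul]
    rcases lt_or_ge (k.1 d) 0 with hkd | hkd
    · have := mul_le_mul_of_nonpos_right (hmin k ⟨hk, hkd⟩) hkd.le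
      rw [div_mul_cancel₀ _ hkd.ne] at this
      linarith
    · have := mul_nonneg hr hkd
      linarith [hy k hk]
  · simp only [map_add, map_smul, smul_eq_mul]
    rw [div_mul_cancel₀ _ hh.2.ne]
    ring

/-- If `x`, `y` are in `K` and `x` is extreme, then `x + ε (x - y) ∈ K` for `ε > 0` forces
`x = y`. -/
theorem eq_of_extreme_of_step {K : Set E} {x y : E} (hx : x ∈ K.extremePoints ℝ) (hy : y ∈ K)
    {ε : ℝ} (hε : 0 < ε) (h : x + ε • (x - y) ∈ K) : x = y := by
  refine (hx.2 hy h ⟨ε / (1 + ε), 1 / (1 + ε), by positivity, by positivity, ?_, ?_⟩).symm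
  · field_simp; ring
  · have h1 : (1 + ε) ≠ 0 := by positivity
    have e : x = (1 + ε)⁻¹ • ((1 + ε) • x) := by rw [smul_smul, inv_mul_cancel₀ h1, one_smul]
    conv_rhs => rw [e]
    rw [div_eq_inv_mul, div_eq_inv_mul, mul_one, mul_smul, ← smul_add]
    congr 1
    rw [smul_sub, add_smul, one_smul]
    abel

/-- An extreme point is determined by its active constraints: if they are all active at `y` too, a
small step from `x` along `x - y` stays feasible, so `x = y`. -/
theorem finite_extremePoints : ((halfspaceInter S).extremePoints ℝ).Finite := by
  classical
  refine Set.Finite.of_finite_image (f := fun y => S.filter fun h => h.1 y = h.2)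
    ((S.powerset.finite_toSet).subset ?_) ?_
  · rintro _ ⟨y, -, rfl⟩
    exact Finset.mem_coe.2 (Finset.mem_powerset.2 (Finset.filter_subset _ S))
  · intro x hx y hy hxy
    have hact : ∀ h ∈ S, h.1 x = h.2 → h.1 y = h.2 := fun h hh he =>
      (Finset.mem_filter.1 ((Finset.ext_iff.1 hxy h).1 (Finset.mem_filter.2 ⟨hh, he⟩))).2
    obtain ⟨ε, hε, hm⟩ := exists_pos_step_mem (d := x - y) hx.1 fun h hh he => by
      rw [map_sub, he, hact h hh he, sub_self]
    exact eq_of_extreme_of_step hx hy.1 hε hm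

/-- A polyhedron without lines is contained in every convex set that contains its vertices and is
closed under adding recession directions. -/
theorem halfspaceInter_subset_of_extremePoints_subset
    (hline : ∀ d : E, (∀ h ∈ S, h.1 d = 0) → d = 0) {X : Set E} (hX : Convex ℝ X)
    (hext : (halfspaceInter S).extremePoints ℝ ⊆ X)
    (hrec : ∀ y ∈ X, ∀ d : E, (∀ h ∈ S, 0 ≤ h.1 d) → y + d ∈ X) :
    halfspaceInter S ⊆ X := by
  classical
  intro y hy
  -- Induction on the number of inactive constraints. A non-extreme point can be moved along a
  -- direction preserving its active constraints until one more becomes active.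
  induction hN : (S.filter fun h => h.1 y ≠ h.2).card using Nat.strong_induction_on
    generalizing y with
  | _ N ih =>
  subst hN
  by_cases hye : y ∈ (halfspaceInter S).extremePoints ℝ
  · exact hext hye
  obtain ⟨d, hd0, hd⟩ : ∃ d : E, d ≠ 0 ∧ ∀ h ∈ S, h.1 y = h.2 → h.1 d = 0 := by
    have : ∃ x₁ ∈ halfspaceInter S, ∃ x₂ ∈ halfspaceInter S, y ∈ openSegment ℝ x₁ x₂ ∧ x₁ ≠ y := by
      by_contra hcon
      push Not at hcon
      exact hye ⟨hy, fun x₁ h₁ x₂ h₂ hs => hcon x₁ h₁ x₂ h₂ hs⟩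
    obtain ⟨x₁, h₁, x₂, h₂, ⟨a, b, ha, hb, hab, rfl⟩, hne⟩ := this
    refine ⟨x₁ - (a • x₁ + b • x₂), sub_ne_zero.2 hne, fun h hh he => ?_⟩
    rw [map_sub, he, sub_eq_zero]
    simp only [map_add, map_smul, smul_eq_mul] at he
    refine le_antisymm ?_ (h₁ h hh)
    by_contra! hlt
    have e : h.2 = a * h.2 + b * h.2 := by rw [← add_mul, hab, one_mul]
    have := mul_le_mul_of_nonneg_left (h₂ h hh) hb.le
    have := mul_lt_mul_of_pos_left hlt ha
    linarith
  have step : ∀ d : E, (∀ h ∈ S, h.1 y = h.2 → h.1 d = 0) → (∃ h ∈ S, h.1 d < 0) →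
      ∃ r : ℝ, 0 ≤ r ∧ y + r • d ∈ X := by
    intro d hd hneg
    obtain ⟨r, hr, hm, k, hk, hkd, hke⟩ := exists_max_step_mem hy hneg
    refine ⟨r, hr, ih _ (Finset.card_lt_card ?_) hm rfl⟩
    rw [Finset.ssubset_iff_of_subset]
    · refine ⟨k, Finset.mem_filter.2 ⟨hk, fun he => hkd.ne (hd k hk he)⟩, fun hkm => ?_⟩
      exact (Finset.mem_filter.1 hkm).2 hke
    · intro h hh
      rw [Finset.mem_filter] at hh ⊢
      refine ⟨hh.1, fun he => hh.2 ?_⟩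
      rw [map_add, map_smul, hd h hh.1 he, smul_zero, add_zero, he]
  have hnd : ∀ h ∈ S, h.1 y = h.2 → h.1 (-d) = 0 := fun h hh he => by
    rw [map_neg, hd h hh he, neg_zero]
  have ray : ∀ d : E, (∀ h ∈ S, h.1 y = h.2 → h.1 d = 0) → (∃ h ∈ S, h.1 d < 0) →
      (¬ ∃ h ∈ S, h.1 (-d) < 0) → y ∈ X := by
    intro d hd h₁ h₂
    push Not at h₂
    obtain ⟨r, hr, hm⟩ := step d hd h₁
    have := hrec _ hm (r • -d) fun h hh => by
      rw [map_smul]; exact smul_nonneg hr (h₂ h hh)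
    simpa using this
  -- Blocked both ways, `y` is a convex combination of the two endpoints; blocked one way, it is an
  -- endpoint plus a recession direction; blocked in neither, `d` spans a line.
  by_cases h₁ : ∃ h ∈ S, h.1 d < 0 <;> by_cases h₂ : ∃ h ∈ S, h.1 (-d) < 0
  · obtain ⟨r, hr, hm⟩ := step d hd h₁
    obtain ⟨s, hs, hm'⟩ := step (-d) hnd h₂
    rcases (add_nonneg hr hs).eq_or_lt with h0 | hpos
    · obtain rfl : r = 0 := by linarith
      simpa using hm
    · have := hX hm hm' (a := s / (r + s)) (b := r / (r + s)) (by positivity) (by positivity)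
        (by field_simp; ring)
      convert this using 1
      rw [smul_add, smul_add, add_add_add_comm, ← add_smul, smul_smul, smul_smul, smul_neg,
        ← sub_eq_add_neg, ← sub_smul]
      have e1 : s / (r + s) + r / (r + s) = 1 := by field_simp; ring
      have e2 : s / (r + s) * r - r / (r + s) * s = 0 := by ring
      rw [e1, e2, one_smul, zero_smul, add_zero]
  · exact ray d hd h₁ h₂
  · exact ray (-d) hnd h₂ (by simpa using h₁)
  · push Not at h₁ h₂
    refine absurd (hline d fun h hh => le_antisymm ?_ (h₁ h hh)) hd0
    simpa using h₂ h hh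

theorem mem_of_forall_nonneg {y d : E} (hy : y ∈ halfspaceInter S)
    (hd : ∀ h ∈ S, 0 ≤ h.1 d) : y + d ∈ halfspaceInter S := fun h hh => by
  rw [map_add]
  linarith [hy h hh, hd h hh]

theorem forall_nonneg_of_forall_mem {y d : E}
    (hd : ∀ s : ℝ, 0 ≤ s → y + s • d ∈ halfspaceInter S) : ∀ h ∈ S, 0 ≤ h.1 d := by
  intro h hh
  by_contra! hneg
  have hy := hd 0 le_rfl h hh
  have h1 : 0 ≤ (h.2 - h.1 y) / h.1 d :=
    div_nonneg_of_nonpos (by simpa using hy) hneg.le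
  have := hd ((h.2 - h.1 y) / h.1 d + 1) (by linarith) h hh
  rw [map_add, map_smul, smul_eq_mul, add_mul, div_mul_cancel₀ _ hneg.ne] at this
  linarith

end Polyhedra

section

variable {k : ℕ}

/-- The functional `y ↦ w ⬝ᵥ y`. -/
def dotFunctional {κ : Type*} [Fintype κ] (w : κ → ℝ) : (κ → ℝ) →ₗ[ℝ] ℝ where
  toFun y := w ⬝ᵥ y
  map_add' := dotProduct_add w
  map_smul' a y := dotProduct_smul a w y

@[simp] theorem dotFunctional_apply {κ : Type*} [Fintype κ] (w y : κ → ℝ) :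
    dotFunctional w y = w ⬝ᵥ y := rfl

theorem exists_eq_dotFunctional {κ : Type*} [Fintype κ] (l : (κ → ℝ) →ₗ[ℝ] ℝ) :
    ∃ w, l = dotFunctional w := by
  classical
  refine ⟨fun i => l (Pi.single i 1), LinearMap.pi_ext' fun i => LinearMap.ext_ring ?_⟩
  simp

theorem isPolyhedron_iff {K : Set (Fin k → ℝ)} :
    IsPolyhedron K ↔ ∃ S : Finset (((Fin k → ℝ) →ₗ[ℝ] ℝ) × ℝ), K = halfspaceInter S := by
  classical
  constructor
  · rintro ⟨r, G, g, rfl⟩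
    refine ⟨Finset.univ.image fun i => (dotFunctional (G i), g i), ?_⟩
    ext y
    simp [halfspaceInter, Pi.le_def, mulVec]
  · rintro ⟨S, rfl⟩
    choose w hw using fun l : (Fin k → ℝ) →ₗ[ℝ] ℝ => exists_eq_dotFunctional l
    refine ⟨S.card, Matrix.of fun i => w (S.equivFin.symm i).1.1,
      fun i => (S.equivFin.symm i).1.2, ?_⟩
    ext y
    have e : ∀ l y, w l ⬝ᵥ y = l y := fun l y => by
      conv_rhs => rw [hw l]
      rfl
    simp only [halfspaceInter, Set.mem_ofPred_eq, Pi.le_def, mulVec, Matrix.of_apply, e]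
    constructor
    · intro h i
      exact h _ (S.equivFin.symm i).2
    · intro h a ha
      simpa using h (S.equivFin ⟨a, ha⟩)

theorem IsPolyhedron.inter_halfspace {K : Set (Fin k → ℝ)} (hK : IsPolyhedron K)
    (l : (Fin k → ℝ) →ₗ[ℝ] ℝ) (β : ℝ) : IsPolyhedron (K ∩ {y | β ≤ l y}) := by
  classical
  obtain ⟨S, rfl⟩ := isPolyhedron_iff.1 hK
  refine isPolyhedron_iff.2 ⟨insert (l, β) S, ?_⟩
  ext y
  simp [halfspaceInter, and_comm]

theorem isPolyhedron_setOf_forall {ι : Type*} [Finite ι] (l : ι → (Fin k → ℝ) →ₗ[ℝ] ℝ)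
    (β : ι → ℝ) : IsPolyhedron {y | ∀ i, β i ≤ l i y} := by
  classical
  have := Fintype.ofFinite ι
  refine isPolyhedron_iff.2 ⟨Finset.univ.image fun i => (l i, β i), ?_⟩
  ext y
  simp [halfspaceInter]

theorem IsPolyhedron.finite_extremePoints {K : Set (Fin k → ℝ)} (hK : IsPolyhedron K) :
    (K.extremePoints ℝ).Finite := by
  obtain ⟨S, rfl⟩ := isPolyhedron_iff.1 hK
  exact _root_.finite_extremePoints

/-- For a polyhedron the recession directions are those on which all defining functionals are
nonnegative, so a ray from one single point suffices. -/
theorem IsPolyhedron.mem_recessionCone_of_ray {K : Set (Fin k → ℝ)} (hK : IsPolyhedron K)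
    {y d : Fin k → ℝ} (hd : ∀ s : ℝ, 0 ≤ s → y + s • d ∈ K) : d ∈ recessionCone K := by
  obtain ⟨S, rfl⟩ := isPolyhedron_iff.1 hK
  intro x hx s hs
  refine mem_of_forall_nonneg hx fun h hh => ?_
  rw [map_smul]
  exact smul_nonneg hs (forall_nonneg_of_forall_mem hd h hh)

theorem IsPolyhedron.subset_of_extremePoints_subset {K X : Set (Fin k → ℝ)} (hK : IsPolyhedron K)
    (hline : ∀ d, d ∈ recessionCone K → -d ∈ recessionCone K → d = 0) (hX : Convex ℝ X)
    (hext : K.extremePoints ℝ ⊆ X)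
    (hrec : ∀ y ∈ X, ∀ d ∈ recessionCone K, y + d ∈ X) : K ⊆ X := by
  obtain ⟨S, rfl⟩ := isPolyhedron_iff.1 hK
  have mem : ∀ d, (∀ h ∈ S, 0 ≤ h.1 d) → d ∈ recessionCone (halfspaceInter S) :=
    fun d hd y hy s hs => mem_of_forall_nonneg hy fun h hh => by
      rw [map_smul]; exact smul_nonneg hs (hd h hh)
  exact halfspaceInter_subset_of_extremePoints_subset
    (fun d hd => hline d (mem d fun h hh => (hd h hh).ge)
      (mem (-d) fun h hh => by rw [map_neg, hd h hh, neg_zero])) hX hext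
    fun y hy d hd => hrec y hy d (mem d hd)

theorem IsPolyhedron.nonempty_extremePoints {K : Set (Fin k → ℝ)} (hK : IsPolyhedron K)
    (hne : K.Nonempty) (hline : ∀ d, d ∈ recessionCone K → -d ∈ recessionCone K → d = 0) :
    (K.extremePoints ℝ).Nonempty := by
  by_contra hcon
  rw [Set.not_nonempty_iff_eq_empty] at hcon
  obtain ⟨y, hy⟩ := hne
  exact hK.subset_of_extremePoints_subset hline (X := ∅) convex_empty hcon.le
    (fun _ h => h.elim) hy

end

/-! ### Cones by generators and by inequalities. -/

section Cones

variable {k : ℕ} {ι κ : Type*} [Fintype ι]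

theorem zero_mem_generatedCone (Y : Matrix (Fin k) ι ℝ) : 0 ∈ generatedCone Y :=
  ⟨0, le_rfl, by simp⟩

theorem add_mem_generatedCone {Y : Matrix (Fin k) ι ℝ} {x y : Fin k → ℝ}
    (hx : x ∈ generatedCone Y) (hy : y ∈ generatedCone Y) : x + y ∈ generatedCone Y := by
  obtain ⟨μ, hμ, rfl⟩ := hx
  obtain ⟨ν, hν, rfl⟩ := hy
  exact ⟨μ + ν, add_nonneg hμ hν, (mulVec_add _ _ _).symm⟩

theorem smul_mem_generatedCone {Y : Matrix (Fin k) ι ℝ} {x : Fin k → ℝ} {s : ℝ} (hs : 0 ≤ s)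
    (hx : x ∈ generatedCone Y) : s • x ∈ generatedCone Y := by
  obtain ⟨μ, hμ, rfl⟩ := hx
  exact ⟨s • μ, smul_nonneg hs hμ, (mulVec_smul _ _ _).symm⟩

theorem transpose_mem_generatedCone (Y : Matrix (Fin k) ι ℝ) (j : ι) :
    Yᵀ j ∈ generatedCone Y := by
  classical
  exact ⟨Pi.single j 1, Pi.single_nonneg.2 zero_le_one, by ext i; simp⟩

theorem mem_inequalityCone {Z : Matrix (Fin k) κ ℝ} {y : Fin k → ℝ} :
    y ∈ inequalityCone Z ↔ ∀ j, 0 ≤ Zᵀ j ⬝ᵥ y := Iff.rfl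

theorem dotProduct_mulVec_eq {n : Type*} [Fintype n] (Y : Matrix (Fin k) n ℝ) (w : Fin k → ℝ)
    (μ : n → ℝ) : w ⬝ᵥ Y *ᵥ μ = (Yᵀ *ᵥ w) ⬝ᵥ μ := by
  rw [dotProduct_mulVec, mulVec_transpose]

theorem nonneg_on_generatedCone_iff {Y : Matrix (Fin k) ι ℝ} {w : Fin k → ℝ} :
    (∀ d ∈ generatedCone Y, 0 ≤ w ⬝ᵥ d) ↔ 0 ≤ Yᵀ *ᵥ w := by
  constructor
  · intro h j
    have := h _ (transpose_mem_generatedCone Y j)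
    rwa [dotProduct_comm] at this
  · rintro h _ ⟨μ, hμ, rfl⟩
    rw [dotProduct_mulVec_eq]
    exact dotProduct_nonneg_of_nonneg h hμ

theorem exists_pos_add_smul_mem_of_mem_interior {R : Set (Fin k → ℝ)} {c : Fin k → ℝ}
    (hc : c ∈ interior R) (v : Fin k → ℝ) : ∃ ε : ℝ, 0 < ε ∧ c + ε • v ∈ R := by
  have hcont : Filter.Tendsto (fun ε : ℝ => c + ε • v) (nhdsWithin 0 (Set.Ioi 0)) (nhds c) := by
    have : Continuous fun ε : ℝ => c + ε • v := by fun_prop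
    simpa using (this.tendsto 0).mono_left nhdsWithin_le_nhds
  obtain ⟨ε, h, hε⟩ := ((hcont.eventually (mem_interior_iff_mem_nhds.1 hc)).and
    self_mem_nhdsWithin).exists
  exact ⟨ε, hε, h⟩

/-- Stepping from the interior point `c` slightly along `-w` stays in `R` but would make the
functional negative unless `w ⬝ᵥ w = 0`. -/
theorem eq_zero_of_nonneg_of_dotProduct_interior {R : Set (Fin k → ℝ)} {c w : Fin k → ℝ}
    (hc : c ∈ interior R) (hw : ∀ d ∈ R, 0 ≤ w ⬝ᵥ d) (h0 : w ⬝ᵥ c = 0) : w = 0 := by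
  obtain ⟨ε, hε, hm⟩ := exists_pos_add_smul_mem_of_mem_interior hc (-w)
  have := hw _ hm
  rw [dotProduct_add, h0, zero_add, dotProduct_smul, dotProduct_neg, smul_eq_mul] at this
  have h1 : 0 ≤ w ⬝ᵥ w := Finset.sum_nonneg fun i _ => mul_self_nonneg (w i)
  have h2 : w ⬝ᵥ w = 0 := by nlinarith
  exact dotProduct_self_eq_zero.1 h2

end Cones

/-! ### Duality of P₂ and D₂; outer approximations of the upper image. -/

namespace QCP

variable {m n k : ℕ} {ι κ : Type*} [Fintype ι]

/-- The standing assumptions of both algorithms: `R` is a pointed cone with the generators `Y` and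
the inequalities `Z`, `c` is an interior point, and the problem is feasible, quasi-concave,
`R`-monotone and `R`-bounded. -/
structure Admissible (p : QCP m n k) (R : Set (Fin k → ℝ)) (Y : Matrix (Fin k) ι ℝ)
    (Z : Matrix (Fin k) κ ℝ) (c : Fin k → ℝ) : Prop where
  gen : R = generatedCone Y
  ineq : R = inequalityCone Z
  pointed : IsPointedCone R
  mem_interior : c ∈ interior R
  neg_notMem : -c ∉ R
  feasible_nonempty : p.feasible.Nonempty
  quasiconcave : QuasiconcaveOn ℝ Set.univ p.f
  monotone : p.AssumptionM R
  bounded : p.AssumptionB R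

theorem mulVec_mem_recessionCone_image (p : QCP m n k) {d : Fin n → ℝ} (hd : 0 ≤ p.A *ᵥ d) :
    p.P *ᵥ d ∈ recessionCone p.image := by
  rintro _ ⟨x, hx, rfl⟩ s hs
  refine ⟨x + s • d, ?_, by rw [mulVec_add, mulVec_smul]⟩
  change p.b ≤ p.A *ᵥ (x + s • d)
  rw [mulVec_add, mulVec_smul]
  exact le_add_of_le_of_nonneg hx (smul_nonneg hs hd)

theorem transpose_mulVec_eq_iff (p : QCP m n k) {u : Fin m → ℝ} {w : Fin k → ℝ} :
    p.Aᵀ *ᵥ u = p.Pᵀ *ᵥ w ↔ ∀ x, u ⬝ᵥ p.A *ᵥ x = w ⬝ᵥ p.P *ᵥ x := by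
  simp only [dotProduct_mulVec_eq]
  exact ⟨fun h x => by rw [h], fun h => dotProduct_eq _ _ h⟩

/-- A linear functional that is nonnegative on `R ⊇ 0⁺P[S]` attains its minimum on `P[S]`, with a
dual certificate `u`. -/
theorem exists_solution_P1 {p : QCP m n k} {R : Set (Fin k → ℝ)} (hS : p.feasible.Nonempty)
    (hB : p.AssumptionB R) {w : Fin k → ℝ} (hw : ∀ d ∈ R, 0 ≤ w ⬝ᵥ d) :
    ∃ x u, p.IsOptimalP1 w x ∧ 0 ≤ u ∧ (∀ v, u ⬝ᵥ p.A *ᵥ v = w ⬝ᵥ p.P *ᵥ v) ∧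
      w ⬝ᵥ p.P *ᵥ x = u ⬝ᵥ p.b := by
  obtain ⟨x, u, hx, hu, he, hv⟩ := exists_linearProgram_solution
    (fun i => dotFunctional (p.A i)) p.b (dotFunctional (p.Pᵀ *ᵥ w)) hS (by
      intro d hd
      have := hw _ (hB (p.mulVec_mem_recessionCone_image hd))
      rwa [dotProduct_mulVec_eq] at this)
  have hdual : ∀ v, u ⬝ᵥ p.A *ᵥ v = w ⬝ᵥ p.P *ᵥ v := by
    intro v
    have := LinearMap.congr_fun he v
    rw [dotFunctional_apply, ← dotProduct_mulVec_eq, LinearMap.sum_apply] at this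
    exact this
  have hval : w ⬝ᵥ p.P *ᵥ x = u ⬝ᵥ p.b := by
    rw [dotProduct_mulVec_eq]
    exact hv
  refine ⟨x, u, ⟨hx, fun v hv => ?_⟩, hu, hdual, hval⟩
  rw [hval, ← hdual v]
  exact dotProduct_le_dotProduct_of_nonneg_left hv hu

variable {p : QCP m n k} {R : Set (Fin k → ℝ)} {Y : Matrix (Fin k) ι ℝ}
  {Z : Matrix (Fin k) κ ℝ} {c : Fin k → ℝ}

theorem nonneg_of_feasibleD2 (h : p.Admissible R Y Z c) {u : Fin m → ℝ} {w : Fin k → ℝ}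
    (hD : p.FeasibleD2 Y c u w) : ∀ d ∈ R, 0 ≤ w ⬝ᵥ d := by
  rw [h.gen]
  exact nonneg_on_generatedCone_iff.2 hD.2.2.1

theorem feasibleP2_iff (h : p.Admissible R Y Z c) {t : Fin k → ℝ} {x : Fin n → ℝ} {z : ℝ} :
    p.FeasibleP2 Z c t x z ↔ x ∈ p.feasible ∧ t + z • c - p.P *ᵥ x ∈ R := by
  rw [h.ineq]
  refine and_congr Iff.rfl ?_
  rw [inequalityCone, Set.mem_ofPred_eq, mulVec_sub, mulVec_add, mulVec_smul, sub_nonneg]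

theorem le_of_feasibleD2 {ι : Type*} {Y : Matrix (Fin k) ι ℝ} {u : Fin m → ℝ} {w : Fin k → ℝ}
    (hD : p.FeasibleD2 Y c u w) {x : Fin n → ℝ} (hx : x ∈ p.feasible) :
    p.b ⬝ᵥ u ≤ w ⬝ᵥ p.P *ᵥ x := by
  rw [← p.transpose_mulVec_eq_iff.1 hD.1 x, dotProduct_comm]
  exact dotProduct_le_dotProduct_of_nonneg_left hx hD.2.2.2

theorem weak_duality (h : p.Admissible R Y Z c) {t : Fin k → ℝ} {x : Fin n → ℝ} {z : ℝ}
    {u : Fin m → ℝ} {w : Fin k → ℝ} (hP : p.FeasibleP2 Z c t x z) (hD : p.FeasibleD2 Y c u w) :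
    p.b ⬝ᵥ u - t ⬝ᵥ w ≤ z := by
  obtain ⟨hx, hR⟩ := (feasibleP2_iff h).1 hP
  have h1 := nonneg_of_feasibleD2 h hD _ hR
  have h2 := le_of_feasibleD2 hD hx
  rw [dotProduct_sub, dotProduct_add, dotProduct_smul, dotProduct_comm w c, hD.2.1, smul_eq_mul,
    mul_one, dotProduct_comm w t] at h1
  linarith

/-- P₂ is a linear program in `(x, z)`. It is feasible because `c` is interior, and `z` is bounded
below because a recession direction with `z < 0` would put `-c` in `R`. The multipliers `v` of the
cone constraints give `w = Z v`. -/
theorem exists_solution_P2D2 [Fintype κ] (h : p.Admissible R Y Z c) (t : Fin k → ℝ) :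
    ∃ x z u w, p.FeasibleP2 Z c t x z ∧ p.FeasibleD2 Y c u w ∧ z = p.b ⬝ᵥ u - t ⬝ᵥ w := by
  have memR : ∀ y, y ∈ R ↔ ∀ j, 0 ≤ Zᵀ j ⬝ᵥ y := fun y => by rw [h.ineq]; exact mem_inequalityCone
  let l : Fin m ⊕ κ → ((Fin n → ℝ) × ℝ) →ₗ[ℝ] ℝ := Sum.elim
    (fun i => (dotFunctional (p.A i)).comp (LinearMap.fst ℝ _ ℝ))
    (fun j => (Zᵀ j ⬝ᵥ c) • LinearMap.snd ℝ _ ℝ -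
      ((dotFunctional (Zᵀ j)).comp p.P.mulVecLin).comp (LinearMap.fst ℝ _ ℝ))
  obtain ⟨⟨x, z⟩, u, hx, hu, he, hv⟩ := exists_linearProgram_solution l
    (Sum.elim p.b fun j => -(Zᵀ j ⬝ᵥ t)) (LinearMap.snd ℝ _ ℝ) (by
      obtain ⟨x, hx⟩ := h.feasible_nonempty
      obtain ⟨ε, hε, hm⟩ := exists_pos_add_smul_mem_of_mem_interior h.mem_interior (t - p.P *ᵥ x)
      refine ⟨(x, ε⁻¹), ?_⟩
      rintro (i | j)
      · exact hx i
      · have := (memR _).1 hm j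
        simp only [dotProduct_add, dotProduct_smul, dotProduct_sub, smul_eq_mul] at this
        simp only [Sum.elim_inr, l, LinearMap.sub_apply, LinearMap.smul_apply,
          LinearMap.snd_apply, LinearMap.comp_apply, LinearMap.fst_apply, smul_eq_mul,
          dotFunctional_apply, mulVecLin_apply]
        have h2 := mul_nonneg (inv_pos.2 hε).le this
        rw [mul_add, ← mul_assoc, inv_mul_cancel₀ hε.ne', one_mul] at h2
        linarith) (by
      rintro ⟨d, z⟩ hd
      have hPd : p.P *ᵥ d ∈ R :=
        h.bounded (p.mulVec_mem_recessionCone_image fun i => hd (Sum.inl i))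
      have hz : z • c ∈ R := (memR _).2 fun j => by
        have h1 := hd (Sum.inr j)
        have h2 := (memR _).1 hPd j
        simp only [Sum.elim_inr, l, LinearMap.sub_apply, LinearMap.smul_apply,
          LinearMap.snd_apply, LinearMap.comp_apply, LinearMap.fst_apply, smul_eq_mul,
          dotFunctional_apply, mulVecLin_apply] at h1
        rw [dotProduct_smul, smul_eq_mul]
        linarith
      by_contra hneg
      simp only [LinearMap.snd_apply, not_le] at hneg
      apply h.neg_notMem
      rw [h.gen] at hz ⊢
      have := smul_mem_generatedCone (s := (-z)⁻¹) (inv_nonneg.2 (neg_nonneg.2 hneg.le)) hz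
      rwa [smul_smul, inv_neg, neg_mul, inv_mul_cancel₀ hneg.ne, neg_one_smul] at this)
  set v : κ → ℝ := fun j => u (Sum.inr j)
  have hZv : ∀ y, (Z *ᵥ v) ⬝ᵥ y = ∑ j, v j * (Zᵀ j ⬝ᵥ y) := fun y => by
    rw [dotProduct_comm, dotProduct_mulVec_eq, dotProduct_comm]
    rfl
  refine ⟨x, z, fun i => u (Sum.inl i), Z *ᵥ v, ?_, ⟨?_, ?_, ?_, fun i => hu _⟩, ?_⟩
  · rw [feasibleP2_iff h]
    refine ⟨fun i => hx (Sum.inl i), (memR _).2 fun j => ?_⟩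
    have := hx (Sum.inr j)
    simp only [Sum.elim_inr, l, LinearMap.sub_apply, LinearMap.smul_apply,
      LinearMap.snd_apply, LinearMap.comp_apply, LinearMap.fst_apply, smul_eq_mul,
      dotFunctional_apply, mulVecLin_apply] at this
    simp only [dotProduct_add, dotProduct_smul, dotProduct_sub, smul_eq_mul]
    linarith
  · rw [p.transpose_mulVec_eq_iff]
    intro y
    have := LinearMap.congr_fun he (y, 0)
    simp only [LinearMap.add_apply, LinearMap.sum_apply, Fintype.sum_sum_type, Sum.elim_inl, Sum.elim_inr, l,
      LinearMap.sub_apply, LinearMap.smul_apply, LinearMap.snd_apply, LinearMap.comp_apply,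
      LinearMap.fst_apply, smul_eq_mul, dotFunctional_apply, mulVecLin_apply, mul_zero,
      zero_sub, mul_neg, Finset.sum_neg_distrib] at this
    rw [hZv]
    exact eq_of_sub_eq_zero this
  · have := LinearMap.congr_fun he (0, 1)
    simp only [LinearMap.add_apply, LinearMap.sum_apply, Fintype.sum_sum_type, Sum.elim_inl, Sum.elim_inr, l,
      LinearMap.sub_apply, LinearMap.smul_apply, LinearMap.snd_apply, LinearMap.comp_apply,
      LinearMap.fst_apply, smul_eq_mul, dotFunctional_apply, mulVecLin_apply, mul_zero,
      mulVec_zero, dotProduct_zero, sub_zero, Finset.sum_const_zero, zero_add, mul_one] at this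
    rw [dotProduct_comm, hZv]
    exact this
  · rw [← nonneg_on_generatedCone_iff, ← h.gen]
    intro d hd
    rw [hZv]
    exact Finset.sum_nonneg fun j _ => mul_nonneg (hu _) ((memR d).1 hd j)
  · simp only [LinearMap.snd_apply, Fintype.sum_sum_type, Sum.elim_inl, Sum.elim_inr, mul_neg,
      Finset.sum_neg_distrib] at hv
    rw [hv, dotProduct_comm t, hZv, dotProduct_comm p.b, ← sub_eq_add_neg]
    rfl

theorem exists_optimal_P2 [Fintype κ] (h : p.Admissible R Y Z c) (t : Fin k → ℝ) :
    ∃ x z, p.IsOptimalP2 Z c t x z := by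
  obtain ⟨x, z, u, w, hP, hD, he⟩ := exists_solution_P2D2 h t
  exact ⟨x, z, hP, fun x' z' h' => he ▸ weak_duality h h' hD⟩

theorem exists_optimal_D2 [Fintype κ] (h : p.Admissible R Y Z c) (t : Fin k → ℝ) :
    ∃ u w, p.IsOptimalD2 Y c t u w := by
  obtain ⟨x, z, u, w, hP, hD, he⟩ := exists_solution_P2D2 h t
  exact ⟨u, w, hD, fun u' w' h' => he ▸ weak_duality h hP h'⟩

theorem strong_duality [Fintype κ] (h : p.Admissible R Y Z c) {t : Fin k → ℝ} {x : Fin n → ℝ} {z : ℝ}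
    {u : Fin m → ℝ} {w : Fin k → ℝ} (hP : p.IsOptimalP2 Z c t x z)
    (hD : p.IsOptimalD2 Y c t u w) : z = p.b ⬝ᵥ u - t ⬝ᵥ w := by
  obtain ⟨x', z', u', w', hP', hD', he⟩ := exists_solution_P2D2 h t
  exact le_antisymm ((hP.2 _ _ hP').trans (he ▸ hD.2 _ _ hD')) (weak_duality h hP.1 hD.1)

theorem image_add_mem_of_assumptionO {O : Set (Fin k → ℝ)}
    (hO : p.AssumptionO R O) {x : Fin n → ℝ} (hx : x ∈ p.feasible) {d : Fin k → ℝ} (hd : d ∈ R) :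
    p.P *ᵥ x + d ∈ O :=
  hO.2.1 ⟨_, ⟨x, hx, rfl⟩, d, hd, rfl⟩

theorem eq_zero_of_mem_of_neg_mem (h : p.Admissible R Y Z c) {d : Fin k → ℝ} (hd : d ∈ R)
    (hd' : -d ∈ R) : d = 0 := by
  have : d ∈ R ∩ {y | -y ∈ R} := ⟨hd, hd'⟩
  rwa [h.pointed] at this

theorem zero_mem (h : p.Admissible R Y Z c) : (0 : Fin k → ℝ) ∈ R :=
  h.gen ▸ zero_mem_generatedCone Y

theorem add_mem (h : p.Admissible R Y Z c) {x y : Fin k → ℝ} (hx : x ∈ R) (hy : y ∈ R) :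
    x + y ∈ R := by
  rw [h.gen] at *
  exact add_mem_generatedCone hx hy

theorem smul_mem (h : p.Admissible R Y Z c) {x : Fin k → ℝ} {s : ℝ} (hs : 0 ≤ s) (hx : x ∈ R) :
    s • x ∈ R := by
  rw [h.gen] at *
  exact smul_mem_generatedCone hs hx

/-- Cutting an outer approximation with a valid inequality. -/
theorem assumptionO_inter (h : p.Admissible R Y Z c) {O : Set (Fin k → ℝ)}
    (hO : p.AssumptionO R O) {w : Fin k → ℝ} {γ : ℝ} (hw : ∀ d ∈ R, 0 ≤ w ⬝ᵥ d)
    (hγ : ∀ x ∈ p.feasible, γ ≤ w ⬝ᵥ p.P *ᵥ x) :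
    p.AssumptionO R (O ∩ {y | γ ≤ w ⬝ᵥ y}) := by
  have hpoly : IsPolyhedron (O ∩ {y | γ ≤ w ⬝ᵥ y}) :=
    hO.1.inter_halfspace (dotFunctional w) γ
  have hsub : p.upperImage R ⊆ O ∩ {y | γ ≤ w ⬝ᵥ y} := by
    intro y hy
    refine ⟨hO.2.1 hy, ?_⟩
    obtain ⟨_, ⟨x, hx, rfl⟩, d, hd, rfl⟩ := hy
    change γ ≤ w ⬝ᵥ (p.P *ᵥ x + d)
    rw [dotProduct_add]
    exact le_add_of_le_of_nonneg (hγ x hx) (hw d hd)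
  refine ⟨hpoly, hsub, Set.Subset.antisymm ?_ ?_⟩
  -- Cutting cannot enlarge the recession cone: the ray along `d` from a point of the upper image
  -- already lies in `O`.
  · intro d hd
    rw [← hO.2.2]
    obtain ⟨x, hx⟩ := h.feasible_nonempty
    exact hO.1.mem_recessionCone_of_ray fun s hs =>
      (hd _ (hsub ⟨_, ⟨x, hx, rfl⟩, 0, zero_mem h, rfl⟩) s hs).1
  · intro d hd y hy s hs
    have hd' := hd
    rw [← hO.2.2] at hd'
    refine ⟨hd' y hy.1 s hs, ?_⟩
    change γ ≤ w ⬝ᵥ (y + s • d)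
    rw [dotProduct_add]
    exact le_add_of_le_of_nonneg hy.2 (hw _ (smul_mem h hs hd))

theorem finite_vertices {O : Set (Fin k → ℝ)} (hO : p.AssumptionO R O) :
    (O.extremePoints ℝ).Finite := hO.1.finite_extremePoints

theorem nonempty_vertices (h : p.Admissible R Y Z c) {O : Set (Fin k → ℝ)}
    (hO : p.AssumptionO R O) : (O.extremePoints ℝ).Nonempty := by
  obtain ⟨x, hx⟩ := h.feasible_nonempty
  refine hO.1.nonempty_extremePoints ⟨_, image_add_mem_of_assumptionO hO hx (zero_mem h)⟩ ?_
  rw [hO.2.2]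
  exact fun d => eq_zero_of_mem_of_neg_mem h

theorem exists_minimal_vertex (h : p.Admissible R Y Z c) {O : Set (Fin k → ℝ)}
    (hO : p.AssumptionO R O) : ∃ (V : Finset (Fin k → ℝ)) (t : Fin k → ℝ),
      (V : Set (Fin k → ℝ)) = O.extremePoints ℝ ∧ t ∈ V ∧ ∀ s ∈ V, p.f t ≤ p.f s := by
  have hV := (finite_vertices hO).coe_toFinset
  have hne : (finite_vertices hO).toFinset.Nonempty := by
    rw [← Finset.coe_nonempty, hV]
    exact nonempty_vertices h hO
  obtain ⟨t, ht, hmin⟩ := Finset.exists_min_image _ p.f hne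
  exact ⟨_, t, hV, ht, hmin⟩

/-- The minimum of `f` over the vertices of an outer approximation is a lower bound for the
problem. -/
theorem le_of_minimal_vertex (h : p.Admissible R Y Z c) {O : Set (Fin k → ℝ)}
    (hO : p.AssumptionO R O) {r : EReal} (hr : ∀ s ∈ O.extremePoints ℝ, r ≤ p.f s)
    {x : Fin n → ℝ} (hx : x ∈ p.feasible) : r ≤ p.f (p.P *ᵥ x) := by
  -- The superlevel set of `f` plus `R` is convex by quasi-concavity, contains the vertices and
  -- absorbs `R`, hence contains all of `O`.
  have hmem : O ⊆ {y | ∃ s, r ≤ p.f s ∧ ∃ d ∈ R, y = s + d} := by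
    refine hO.1.subset_of_extremePoints_subset ?_ ?_ ?_ ?_
    · rw [hO.2.2]
      exact fun d => eq_zero_of_mem_of_neg_mem h
    · rintro _ ⟨s₁, h₁, d₁, hd₁, rfl⟩ _ ⟨s₂, h₂, d₂, hd₂, rfl⟩ a b ha hb hab
      refine ⟨a • s₁ + b • s₂, (h.quasiconcave r ⟨trivial, h₁⟩ ⟨trivial, h₂⟩ ha hb hab).2,
        a • d₁ + b • d₂, add_mem h (smul_mem h ha hd₁) (smul_mem h hb hd₂), ?_⟩
      rw [smul_add, smul_add]
      abel
    · exact fun s hs => ⟨s, hr s hs, 0, zero_mem h, (add_zero s).symm⟩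
    · rintro _ ⟨s, hs, d, hd, rfl⟩ e he
      rw [hO.2.2] at he
      exact ⟨s, hs, d + e, add_mem h hd he, add_assoc _ _ _⟩
  have hxO := image_add_mem_of_assumptionO hO hx (zero_mem h)
  rw [add_zero] at hxO
  obtain ⟨s, hs, d, hd, he⟩ := hmem hxO
  -- The point `s` is `Px - d`, so it lies in P[S] - R, which is exactly where monotonicity is
  -- assumed.
  refine hs.trans (h.monotone _ ⟨_, ⟨x, hx, rfl⟩, d, hd, ?_⟩ _
    ⟨_, ⟨x, hx, rfl⟩, 0, zero_mem h, (sub_zero _).symm⟩ ?_)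
  · rw [he, add_sub_cancel_right]
  · rwa [he, add_sub_cancel_left]

/-- A vertex of an outer approximation that belongs to `P[S] + R` belongs to `P[S]`. -/
theorem eq_image_of_vertex (h : p.Admissible R Y Z c) {O : Set (Fin k → ℝ)}
    (hO : p.AssumptionO R O) {t : Fin k → ℝ} (ht : t ∈ O.extremePoints ℝ) {x : Fin n → ℝ}
    (hx : x ∈ p.feasible) (hd : t - p.P *ᵥ x ∈ R) : t = p.P *ᵥ x := by
  -- With `t = Px + d`, both `Px` and `Px + 2d` lie in `O` and `t` is their midpoint.
  refine eq_of_extreme_of_step ht ?_ one_pos ?_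
  · simpa using image_add_mem_of_assumptionO hO hx (zero_mem h)
  · have := image_add_mem_of_assumptionO hO hx (add_mem h hd hd)
    convert this using 1
    rw [one_smul]
    abel

theorem eq_image_of_vertex_of_feasibleP2 (h : p.Admissible R Y Z c) {O : Set (Fin k → ℝ)}
    (hO : p.AssumptionO R O) {t : Fin k → ℝ} (ht : t ∈ O.extremePoints ℝ) {x : Fin n → ℝ} {z : ℝ}
    (hP : p.FeasibleP2 Z c t x z) (hz : z ≤ 0) : t = p.P *ᵥ x := by
  obtain ⟨hx, hR⟩ := (feasibleP2_iff h).1 hP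
  refine eq_image_of_vertex h hO ht hx ?_
  have := add_mem h hR (smul_mem h (neg_nonneg.2 hz) (interior_subset h.mem_interior))
  convert this using 1
  rw [neg_smul]
  abel

end QCP

/-! ### Termination by a well-founded rank. -/

/-- Correctness and finiteness from an invariant and a decreasing rank. -/
theorem correctAndFinite_of_rank {σ α β : Type*} [Preorder β] [WellFoundedLT β]
    {step : σ → σ → Prop} {start : σ} {halt : α → σ} {Spec : α → Prop} (Inv : σ → Prop)
    (rank : σ → β) (h0 : Inv start)
    (hstep : ∀ s s', Inv s → step s s' → Inv s' ∧ rank s' < rank s)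
    (hprog : ∀ s, Inv s → (∃ x, s = halt x) ∨ ∃ s', step s s')
    (hhalt : ∀ x, Inv (halt x) → Spec x) : CorrectAndFinite step start halt Spec := by
  have hInv : ∀ s, Relation.ReflTransGen step start s → Inv s := by
    intro s hs
    induction hs with
    | refl => exact h0
    | tail _ hst ih => exact (hstep _ _ ih hst).1
  refine ⟨fun s hs => hprog s (hInv s hs), ?_, fun x hx => hhalt x (hInv _ hx)⟩
  rintro ⟨run, hrun0, hrun⟩
  have hI : ∀ i, Inv (run i) := by
    intro i
    induction i with
    | zero => exact hrun0 ▸ h0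
    | succ i ih => exact (hstep _ _ ih (hrun i)).1
  obtain ⟨_, ⟨i, rfl⟩, hmin⟩ := WellFounded.has_min (wellFounded_lt (α := β))
    (Set.range fun i => rank (run i)) ⟨_, 0, rfl⟩
  exact hmin _ ⟨i + 1, rfl⟩ (hstep _ _ (hI i) (hrun i)).2

theorem CorrectAndFinite.mono {σ α : Type*} {step : σ → σ → Prop} {start : σ} {halt : α → σ}
    {Spec Spec' : α → Prop} (h : CorrectAndFinite step start halt Spec)
    (hS : ∀ x, Spec x → Spec' x) : CorrectAndFinite step start halt Spec' :=
  ⟨h.1, h.2.1, fun x hx => hS x (h.2.2 x hx)⟩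

namespace QCP

/-! ### The primal algorithm. -/

section Primal

variable {m n k : ℕ} {ι κ : Type*} [Fintype ι]
  {p : QCP m n k} {R : Set (Fin k → ℝ)} {Y : Matrix (Fin k) ι ℝ}
  {Z : Matrix (Fin k) κ ℝ} {c : Fin k → ℝ}

/-- The support pattern of a feasible point of `D₂`, which determines the face of `P[S] + R`
exposed by it. -/
def supportPattern (Y : Matrix (Fin k) ι ℝ) (u : Fin m → ℝ) (w : Fin k → ℝ) :
    Set (Fin m) × Set ι :=
  ({i | u i ≠ 0}, {j | (Yᵀ *ᵥ w) j ≠ 0})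

/-- The support patterns of the inequalities `wᵀy ≥ bᵀu` that are not yet valid for `O`. -/
def unusedPatterns (p : QCP m n k) (Y : Matrix (Fin k) ι ℝ) (c : Fin k → ℝ)
    (O : Set (Fin k → ℝ)) : Set (Set (Fin m) × Set ι) :=
  {J | ¬ ∃ u w, p.FeasibleD2 Y c u w ∧ supportPattern Y u w = J ∧ ∀ y ∈ O, p.b ⬝ᵥ u ≤ w ⬝ᵥ y}

theorem dotProduct_eq_zero_of_support {ι : Type*} [Fintype ι] {v v' a : ι → ℝ} (ha : 0 ≤ a)
    (hv : 0 ≤ v) (h : v ⬝ᵥ a = 0) (hs : {i | v' i ≠ 0} = {i | v i ≠ 0}) : v' ⬝ᵥ a = 0 := by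
  have h0 := (Finset.sum_eq_zero_iff_of_nonneg fun i _ => mul_nonneg (hv i) (ha i)).1 h
  refine Finset.sum_eq_zero fun i hi => ?_
  rcases mul_eq_zero.1 (h0 i hi) with h1 | h1
  · have : i ∉ {i | v' i ≠ 0} := by rw [hs]; simpa using h1
    rw [not_not.1 this, zero_mul]
  · rw [h1, mul_zero]

/-- Complementary slackness: at `Px + Yμ` the slack of the inequality is `u ⬝ᵥ (Ax - b) + (Yᵀw) ⬝ᵥ
μ`, a sum of nonnegative products whose vanishing depends on `u` and `Yᵀw` only through their
supports. -/
theorem dotProduct_image_eq_of_supportPattern {Y : Matrix (Fin k) ι ℝ}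
    {u u' : Fin m → ℝ} {w w' : Fin k → ℝ} (hD : p.FeasibleD2 Y c u w)
    (hD' : p.FeasibleD2 Y c u' w') (hpat : supportPattern Y u' w' = supportPattern Y u w)
    {x : Fin n → ℝ} (hx : x ∈ p.feasible) {d : Fin k → ℝ} (hd : d ∈ generatedCone Y)
    (h : w ⬝ᵥ (p.P *ᵥ x + d) = p.b ⬝ᵥ u) : w' ⬝ᵥ (p.P *ᵥ x + d) = p.b ⬝ᵥ u' := by
  obtain ⟨μ, hμ, rfl⟩ := hd
  have key : ∀ {u : Fin m → ℝ} {w : Fin k → ℝ}, p.FeasibleD2 Y c u w →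
      w ⬝ᵥ (p.P *ᵥ x + Y *ᵥ μ) - p.b ⬝ᵥ u = u ⬝ᵥ (p.A *ᵥ x - p.b) + (Yᵀ *ᵥ w) ⬝ᵥ μ := by
    intro u w hD
    rw [dotProduct_add, ← p.transpose_mulVec_eq_iff.1 hD.1 x, dotProduct_mulVec_eq Y,
      dotProduct_sub, dotProduct_comm p.b u]
    ring
  have hsl : 0 ≤ p.A *ᵥ x - p.b := sub_nonneg.2 hx
  have e := key hD
  rw [h, sub_self] at e
  have h1 : 0 ≤ u ⬝ᵥ (p.A *ᵥ x - p.b) := dotProduct_nonneg_of_nonneg hD.2.2.2 hsl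
  have h2 : 0 ≤ (Yᵀ *ᵥ w) ⬝ᵥ μ := dotProduct_nonneg_of_nonneg hD.2.2.1 hμ
  have e' := key hD'
  rw [dotProduct_eq_zero_of_support hsl hD.2.2.2 (by linarith) (congrArg Prod.fst hpat),
    dotProduct_eq_zero_of_support hμ hD.2.2.1 (by linarith) (congrArg Prod.snd hpat)] at e'
  linarith

/-- A cut at a point `t ∈ O` with `z > 0` uses a new support pattern. -/
theorem unusedPatterns_cut_ssubset (h : p.Admissible R Y Z c) {O : Set (Fin k → ℝ)}
    {t : Fin k → ℝ} (ht : t ∈ O) {x : Fin n → ℝ} {z : ℝ} {u : Fin m → ℝ} {w : Fin k → ℝ}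
    (hP : p.FeasibleP2 Z c t x z) (hD : p.FeasibleD2 Y c u w) (he : z = p.b ⬝ᵥ u - t ⬝ᵥ w)
    (hz : 0 < z) :
    unusedPatterns p Y c (O ∩ {y | p.b ⬝ᵥ u ≤ w ⬝ᵥ y}) ⊂ unusedPatterns p Y c O := by
  rw [Set.ssubset_iff_of_subset fun J hJ ⟨u', w', h1, h2, h3⟩ =>
    hJ ⟨u', w', h1, h2, fun y hy => h3 y hy.1⟩]
  refine ⟨supportPattern Y u w, ?_, fun hJ => hJ ⟨u, w, hD, rfl, fun y hy => hy.2⟩⟩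
  rintro ⟨u', w', hD', hpat, hval⟩
  obtain ⟨hx, hR⟩ := (feasibleP2_iff h).1 hP
  have hval2 : ∀ v : Fin k → ℝ, c ⬝ᵥ v = 1 →
      v ⬝ᵥ (p.P *ᵥ x + (t + z • c - p.P *ᵥ x)) = v ⬝ᵥ t + z := by
    intro v hv
    rw [add_sub_cancel, dotProduct_add, dotProduct_smul, dotProduct_comm v c, hv, smul_eq_mul,
      mul_one]
  -- By strong duality the cut is tight at `t + z c`, a point of the upper image. An inequality with
  -- the same pattern is then tight there as well, so by `c ⬝ᵥ w' = 1` it fails at `t` by exactly `z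
  -- > 0`.
  have := dotProduct_image_eq_of_supportPattern hD hD' hpat hx (h.gen ▸ hR) (by
    rw [hval2 w hD.2.1, he, dotProduct_comm t]
    ring)
  rw [hval2 w' hD'.2.1] at this
  linarith [hval t ht]

/-- The invariant of the primal algorithm. -/
def primalInvariant (p : QCP m n k) (R : Set (Fin k → ℝ)) (Y : Matrix (Fin k) ι ℝ)
    (Z : Matrix (Fin k) κ ℝ) (c : Fin k → ℝ) : PrimalState m n k → Prop
  | .loop O => p.AssumptionO R O
  | .chosen O t => p.AssumptionO R O ∧ t ∈ O.extremePoints ℝ ∧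
      ∀ s ∈ O.extremePoints ℝ, p.f t ≤ p.f s
  | .solved O x z u w => p.AssumptionO R O ∧ ∃ t ∈ O.extremePoints ℝ,
      (∀ s ∈ O.extremePoints ℝ, p.f t ≤ p.f s) ∧ p.IsOptimalP2 Z c t x z ∧ p.IsOptimalD2 Y c t u w
  | .halt x => p.IsOptimal x

/-- The rank that decreases in each step of the primal algorithm. -/
noncomputable def primalRank (p : QCP m n k) (Y : Matrix (Fin k) ι ℝ) (c : Fin k → ℝ) :
    PrimalState m n k → ℕ ×ₗ ℕ
  | .loop O => toLex ((unusedPatterns p Y c O).ncard, 3)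
  | .chosen O _ => toLex ((unusedPatterns p Y c O).ncard, 2)
  | .solved O _ _ _ _ => toLex ((unusedPatterns p Y c O).ncard, 1)
  | .halt _ => toLex (0, 0)

theorem primal_correctAndFinite [Fintype κ] (h : p.Admissible R Y Z c) {O : Set (Fin k → ℝ)}
    (hO : p.AssumptionO R O) :
    CorrectAndFinite (PrimalStep p Y Z c) (.loop O) PrimalState.halt p.IsOptimal := by
  refine correctAndFinite_of_rank (primalInvariant p R Y Z c) (primalRank p Y c) hO ?_ ?_
    fun x hx => hx
  · rintro _ _ hI (⟨O, V, t, hV, ht, hmin⟩ | ⟨O, t, x, z, u, w, hP, hD⟩ |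
      ⟨O, x, z, u, w, hz⟩ | ⟨O, x, z, u, w, hz⟩)
    · refine ⟨⟨hI, hV ▸ ht, ?_⟩, Prod.Lex.toLex_lt_toLex.2 (Or.inr ⟨rfl, by norm_num⟩)⟩
      rw [← hV]
      exact hmin
    · exact ⟨⟨hI.1, t, hI.2.1, hI.2.2, hP, hD⟩,
        Prod.Lex.toLex_lt_toLex.2 (Or.inr ⟨rfl, by norm_num⟩)⟩
    · obtain ⟨hO, t, ht, -, hP, hD⟩ := hI
      refine ⟨assumptionO_inter h hO (nonneg_of_feasibleD2 h hD.1) fun x hx =>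
        le_of_feasibleD2 hD.1 hx, Prod.Lex.toLex_lt_toLex.2 (Or.inl ?_)⟩
      exact Set.ncard_lt_ncard
        (unusedPatterns_cut_ssubset h ht.1 hP.1 hD.1 (strong_duality h hP hD) hz)
    · obtain ⟨hO, t, ht, hmin, hP, hD⟩ := hI
      refine ⟨⟨hP.1.1, fun v hv => ?_⟩, Prod.Lex.toLex_lt_toLex.2 ?_⟩
      · rw [← eq_image_of_vertex_of_feasibleP2 h hO ht hP.1 (not_lt.1 hz)]
        exact le_of_minimal_vertex h hO hmin hv
      -- The halting rank is `(0, 0)`: when no pattern is left unused, the second component decides.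
      · rcases Nat.eq_zero_or_pos (unusedPatterns p Y c O).ncard with h0 | h0
        · exact Or.inr ⟨h0.symm, one_pos⟩
        · exact Or.inl h0
  · rintro (O | ⟨O, t⟩ | ⟨O, x, z, u, w⟩ | x) hI
    · obtain ⟨V, t, hV, ht, hmin⟩ := exists_minimal_vertex h hI
      exact Or.inr ⟨_, .choose O V t hV ht hmin⟩
    · obtain ⟨x, z, hP⟩ := exists_optimal_P2 h t
      obtain ⟨u, w, hD⟩ := exists_optimal_D2 h t
      exact Or.inr ⟨_, .solve O t x z u w hP hD⟩
    · by_cases hz : 0 < z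
      · exact Or.inr ⟨_, .cut O x z u w hz⟩
      · exact Or.inr ⟨_, .finish O x z u w hz⟩
    · exact Or.inl ⟨x, rfl⟩

end Primal

/-! ### The dual algorithm. -/

section Dual

variable {m n d : ℕ} {ι κ : Type*} [Fintype ι]
  {p : QCP m n (d + 1)} {R : Set (Fin (d + 1) → ℝ)} {Y : Matrix (Fin (d + 1)) ι ℝ}
  {Z : Matrix (Fin (d + 1)) κ ℝ} {c : Fin (d + 1) → ℝ}

theorem dotProduct_fin_succ (v y : Fin (d + 1) → ℝ) :
    v ⬝ᵥ y = (∑ i : Fin d, v i.castSucc * y i.castSucc) + v (Fin.last d) * y (Fin.last d) :=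
  Fin.sum_univ_castSucc _

theorem snoc_castSucc_last (y : Fin (d + 1) → ℝ) :
    Fin.snoc (α := fun _ => ℝ) (fun i => y i.castSucc) (y (Fin.last d)) = y :=
  Fin.snoc_init_self y

theorem coupling_eq (c y ys : Fin (d + 1) → ℝ) :
    coupling c y ys = omegaVec c (fun i => ys i.castSucc) ⬝ᵥ y - ys (Fin.last d) := by
  rw [dotProduct_fin_succ]
  simp only [coupling, omegaVec, Fin.snoc_castSucc, Fin.snoc_last]
  rw [Finset.sum_congr rfl fun i _ => mul_comm _ _, mul_comm (y (Fin.last d))]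

theorem coupling_snoc (c y : Fin (d + 1) → ℝ) (a : Fin d → ℝ) (τ : ℝ) :
    coupling c y (Fin.snoc (α := fun _ => ℝ) a τ) = omegaVec c a ⬝ᵥ y - τ := by
  rw [coupling_eq]
  simp only [Fin.snoc_castSucc, Fin.snoc_last]

/-- When `c_{d+1} = 1`, the normalization `cᵀw = 1` determines the last component of `w`. This is
where the extra hypothesis on `c` enters: D₂-feasible vectors become points of the dual space. -/
theorem omegaVec_castSucc (hc : c (Fin.last d) = 1) {w : Fin (d + 1) → ℝ} (hw : c ⬝ᵥ w = 1) :
    omegaVec c (fun i => w i.castSucc) = w := by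
  rw [dotProduct_fin_succ, hc, one_mul] at hw
  conv_rhs => rw [← snoc_castSucc_last w]
  rw [omegaVec]
  congr 1
  linarith

/-- The linear part of `y* ↦ ωᵀ(y*) y`, extended by `δ` in the last component. -/
def couplingVec (c y : Fin (d + 1) → ℝ) (δ : ℝ) : Fin (d + 1) → ℝ :=
  Fin.snoc (α := fun _ => ℝ) (fun i => y i.castSucc - y (Fin.last d) * c i.castSucc) δ

theorem omegaVec_dotProduct (c y ys : Fin (d + 1) → ℝ) :
    omegaVec c (fun i => ys i.castSucc) ⬝ᵥ y = y (Fin.last d) + couplingVec c y 0 ⬝ᵥ ys := by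
  rw [dotProduct_fin_succ, dotProduct_fin_succ]
  simp only [omegaVec, couplingVec, Fin.snoc_castSucc, Fin.snoc_last, sub_mul,
    Finset.sum_sub_distrib, mul_assoc, ← Finset.mul_sum]
  rw [Finset.sum_congr rfl fun i _ => mul_comm (ys i.castSucc) (y i.castSucc)]
  ring

theorem coupling_eq_couplingVec (c y ys : Fin (d + 1) → ℝ) :
    coupling c y ys = y (Fin.last d) + couplingVec c y (-1) ⬝ᵥ ys := by
  rw [coupling_eq, omegaVec_dotProduct, dotProduct_fin_succ, dotProduct_fin_succ]
  simp only [couplingVec, Fin.snoc_castSucc, Fin.snoc_last]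
  ring

theorem setOf_coupling_nonneg (c y : Fin (d + 1) → ℝ) : {ys | 0 ≤ coupling c y ys} =
    {ys | -y (Fin.last d) ≤ dotFunctional (couplingVec c y (-1)) ys} := by
  ext ys
  rw [Set.mem_ofPred_eq, Set.mem_ofPred_eq, coupling_eq_couplingVec, dotFunctional_apply,
    neg_le_iff_add_nonneg']

/-- The set of constraints `Ax ≥ b` that are active at `x`. -/
def activeSet (p : QCP m n (d + 1)) (x : Fin n → ℝ) : Set (Fin m) :=
  {i | (p.A *ᵥ x) i = p.b i}

/-- A dual solution `u` for `w` is supported on the constraints active at the optimal `x`; both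
values therefore equal `u ⬝ᵥ b`. -/
theorem dotProduct_image_eq_of_activeSet (hS : p.feasible.Nonempty) (hB : p.AssumptionB R)
    {w : Fin (d + 1) → ℝ} (hw : ∀ v ∈ R, 0 ≤ w ⬝ᵥ v) {x x' : Fin n → ℝ}
    (hx : p.IsOptimalP1 w x) (hact : activeSet p x' = activeSet p x) :
    w ⬝ᵥ p.P *ᵥ x' = w ⬝ᵥ p.P *ᵥ x := by
  obtain ⟨x₀, u, hx₀, hu, hdual, hval⟩ := exists_solution_P1 hS hB hw
  have hle := hx.2 x₀ hx₀.1
  rw [hval, ← hdual x] at hle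
  have hsl : ∀ i ∈ Finset.univ, u i * p.b i ≤ u i * (p.A *ᵥ x) i :=
    fun i _ => mul_le_mul_of_nonneg_left (hx.1 i) (hu i)
  have heq := (Finset.sum_eq_sum_iff_of_le hsl).1 (le_antisymm (Finset.sum_le_sum hsl) hle)
  rw [← hdual, ← hdual]
  refine Finset.sum_congr rfl fun i hi => ?_
  rcases mul_eq_mul_left_iff.1 (heq i hi) with h | h
  · have : i ∈ activeSet p x' := hact ▸ h.symm
    rw [← h, show (p.A *ᵥ x') i = p.b i from this]
  · rw [h, zero_mul, zero_mul]

/-- The active sets of the cuts `φ(Px, ·) ≥ 0` that are not yet valid for `Os`. -/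
def unusedActiveSets (p : QCP m n (d + 1)) (c : Fin (d + 1) → ℝ) (Os : Set (Fin (d + 1) → ℝ)) :
    Set (Set (Fin m)) :=
  {J | ¬ ∃ x ∈ p.feasible, activeSet p x = J ∧ ∀ ys ∈ Os, 0 ≤ coupling c (p.P *ᵥ x) ys}

/-- A point with the active set of `x` gives the same value of `ω(a)`, so its cut also fails at `(a,
τ)` and cannot have been valid for `Os`. -/
theorem unusedActiveSets_cut_ssubset (hS : p.feasible.Nonempty) (hB : p.AssumptionB R)
    {a : Fin d → ℝ} (ha : ∀ v ∈ R, 0 ≤ omegaVec c a ⬝ᵥ v) {x : Fin n → ℝ}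
    (hx : p.IsOptimalP1 (omegaVec c a) x) {Os : Set (Fin (d + 1) → ℝ)} {τ : ℝ}
    (hτ : omegaVec c a ⬝ᵥ p.P *ᵥ x < τ) (hmem : Fin.snoc (α := fun _ => ℝ) a τ ∈ Os) :
    unusedActiveSets p c (Os ∩ {ys | 0 ≤ coupling c (p.P *ᵥ x) ys}) ⊂ unusedActiveSets p c Os := by
  rw [Set.ssubset_iff_of_subset fun J hJ ⟨x', h1, h2, h3⟩ =>
    hJ ⟨x', h1, h2, fun y hy => h3 y hy.1⟩]
  refine ⟨activeSet p x, ?_, fun hJ => hJ ⟨x, hx.1, rfl, fun y hy => hy.2⟩⟩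
  rintro ⟨x', hx', hact, hval⟩
  have := hval _ hmem
  rw [coupling_snoc, dotProduct_image_eq_of_activeSet hS hB ha hx hact] at this
  linarith

/-- `Os` and `O` are outer approximations of the lower and the upper image, and the points of `Ts`
satisfy the coupling inequality on `O`. -/
structure DualApprox (p : QCP m n (d + 1)) (R : Set (Fin (d + 1) → ℝ)) (c : Fin (d + 1) → ℝ)
    (Os Ts O : Set (Fin (d + 1) → ℝ)) : Prop where
  primal : p.AssumptionO R O
  isPolyhedron : IsPolyhedron Os
  nonneg : ∀ ys ∈ Os, ∀ v ∈ R, 0 ≤ omegaVec c (fun i => ys i.castSucc) ⬝ᵥ v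
  mem : ∀ a β, (∀ v ∈ R, 0 ≤ omegaVec c a ⬝ᵥ v) →
    (∀ x ∈ p.feasible, β ≤ omegaVec c a ⬝ᵥ p.P *ᵥ x) → Fin.snoc (α := fun _ => ℝ) a β ∈ Os
  marked : ∀ ts ∈ Ts, ∀ y ∈ O, 0 ≤ coupling c y ts

/-- `Os` has been cut at least once. -/
def HasCut (c : Fin (d + 1) → ℝ) (Os : Set (Fin (d + 1) → ℝ)) : Prop :=
  ∃ y, ∀ ys ∈ Os, 0 ≤ coupling c y ys

theorem nonneg_of_forall_nonneg_add {a b : ℝ} (h : ∀ s : ℝ, 0 ≤ s → 0 ≤ a + s * b) : 0 ≤ b := by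
  by_contra! hb
  have h1 := h 0 le_rfl
  have h2 := h ((a + 1) / -b) (div_nonneg (by linarith) (by linarith))
  rw [div_mul_eq_mul_div, mul_div_assoc, div_neg, div_self hb.ne] at h2
  linarith

/-- The recession cone of a cut outer approximation of the lower image is contained in the ray
generated by `-e_{d+1}`. -/
theorem recession_of_hasCut (h : p.Admissible R Y Z c) (hc : c (Fin.last d) = 1)
    {Os Ts O : Set (Fin (d + 1) → ℝ)} (hA : DualApprox p R c Os Ts O) (hcut : HasCut c Os)
    (hne : Os.Nonempty) {r : Fin (d + 1) → ℝ} (hr : r ∈ recessionCone Os) :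
    (∀ i : Fin d, r i.castSucc = 0) ∧ r (Fin.last d) ≤ 0 := by
  obtain ⟨y₀, hy₀⟩ := hne
  obtain ⟨y, hy⟩ := hcut
  -- The linear part of `ω` applied to `r`. It is nonnegative on `R` because `ω` is along the whole
  -- ray, and orthogonal to `c` because `c_{d+1} = 1`; hence it is zero.
  set w : Fin (d + 1) → ℝ := Fin.snoc (α := fun _ => ℝ) (fun i => r i.castSucc)
    (-∑ i : Fin d, c i.castSucc * r i.castSucc) with hw
  have hwv : ∀ v, couplingVec c v 0 ⬝ᵥ r = w ⬝ᵥ v := by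
    intro v
    rw [dotProduct_fin_succ, dotProduct_fin_succ]
    simp only [hw, couplingVec, Fin.snoc_castSucc, Fin.snoc_last, sub_mul,
      Finset.sum_sub_distrib, mul_assoc, ← Finset.mul_sum]
    have e : ∑ i : Fin d, r i.castSucc * v i.castSucc = ∑ i : Fin d, v i.castSucc * r i.castSucc :=
      Finset.sum_congr rfl fun i _ => mul_comm _ _
    rw [e]
    ring
  have hw0 : w = 0 := by
    refine eq_zero_of_nonneg_of_dotProduct_interior h.mem_interior (fun v hv => ?_) ?_
    · refine nonneg_of_forall_nonneg_add
        (a := omegaVec c (fun i => y₀ i.castSucc) ⬝ᵥ v) fun s hs => ?_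
      have := hA.nonneg _ (hr y₀ hy₀ s hs) v hv
      rw [omegaVec_dotProduct, dotProduct_add, dotProduct_smul, hwv, ← add_assoc,
        ← omegaVec_dotProduct] at this
      exact this
    · rw [dotProduct_fin_succ, hc]
      simp only [hw, Fin.snoc_castSucc, Fin.snoc_last]
      rw [Finset.sum_congr rfl fun i _ => mul_comm (r i.castSucc) (c i.castSucc)]
      ring
  have hr0 : ∀ i : Fin d, r i.castSucc = 0 := fun i => by
    have := congrFun hw0 i.castSucc
    rwa [hw, Fin.snoc_castSucc] at this
  refine ⟨hr0, neg_nonneg.1 (nonneg_of_forall_nonneg_add (a := coupling c y y₀) fun s hs => ?_)⟩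
  have := hy _ (hr y₀ hy₀ s hs)
  rw [coupling_eq_couplingVec, dotProduct_add, dotProduct_smul, ← add_assoc,
    ← coupling_eq_couplingVec, dotProduct_fin_succ (couplingVec c y (-1)) r] at this
  simpa [hr0, couplingVec] using this

/-- The initial 𝒪* is invariant under changes of the last coordinate and has no vertices; one cut is
what makes it line-free. The starting value `∞` of `t*_{d+1}` forces that cut in the first pass. -/
theorem line_free_of_hasCut (h : p.Admissible R Y Z c) (hc : c (Fin.last d) = 1)
    {Os Ts O : Set (Fin (d + 1) → ℝ)} (hA : DualApprox p R c Os Ts O) (hcut : HasCut c Os)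
    (hne : Os.Nonempty) (r : Fin (d + 1) → ℝ) (hr : r ∈ recessionCone Os)
    (hr' : -r ∈ recessionCone Os) : r = 0 := by
  have h1 := recession_of_hasCut h hc hA hcut hne hr
  have h2 := (recession_of_hasCut h hc hA hcut hne hr').2
  rw [Pi.neg_apply] at h2
  funext i
  refine Fin.lastCases ?_ h1.1 i
  exact le_antisymm h1.2 (neg_nonpos.1 h2)

theorem dual_nonempty (h : p.Admissible R Y Z c) (hc : c (Fin.last d) = 1) [Fintype κ]
    {Os Ts O : Set (Fin (d + 1) → ℝ)} (hA : DualApprox p R c Os Ts O) : Os.Nonempty := by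
  obtain ⟨x, z, u, w, -, hD, -⟩ := exists_solution_P2D2 h 0
  have e := omegaVec_castSucc hc hD.2.1
  refine ⟨_, hA.mem (fun i => w i.castSucc) (p.b ⬝ᵥ u) ?_ ?_⟩ <;> rw [e]
  · exact nonneg_of_feasibleD2 h hD
  · exact fun x hx => le_of_feasibleD2 hD hx

/-- If the coupling function with `t` is nonnegative on the vertices of `Os`, then the vertex `t`
of `O` belongs to `P[S]`. -/
theorem exists_eq_image_of_coupling_nonneg (h : p.Admissible R Y Z c) (hc : c (Fin.last d) = 1)
    [Fintype κ] {Os Ts O : Set (Fin (d + 1) → ℝ)} (hA : DualApprox p R c Os Ts O)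
    (hcut : HasCut c Os) {t : Fin (d + 1) → ℝ} (ht : t ∈ O.extremePoints ℝ)
    (hnn : ∀ ys ∈ Os.extremePoints ℝ, 0 ≤ coupling c t ys) :
    ∃ x ∈ p.feasible, t = p.P *ᵥ x := by
  have hne := dual_nonempty h hc hA
  -- The coupling function is affine in its second argument and does not decrease along `-e_{d+1}`,
  -- so nonnegativity spreads from the vertices to all of `Os`.
  have hsub : Os ⊆ {ys | 0 ≤ coupling c t ys} := by
    refine hA.isPolyhedron.subset_of_extremePoints_subset (line_free_of_hasCut h hc hA hcut hne)
      ?_ hnn ?_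
    · rw [setOf_coupling_nonneg]
      exact convex_halfSpace_ge (dotFunctional _).isLinear _
    · intro y hy r hr
      obtain ⟨h1, h2⟩ := recession_of_hasCut h hc hA hcut hne hr
      change 0 ≤ coupling c t (y + r)
      rw [coupling_eq_couplingVec, dotProduct_add, ← add_assoc, ← coupling_eq_couplingVec,
        dotProduct_fin_succ (couplingVec c t (-1)) r]
      have h3 : 0 ≤ coupling c t y := hy
      simp [h1, couplingVec]
      linarith
  obtain ⟨x, z, u, w, hP, hD, he⟩ := exists_solution_P2D2 h t
  have e := omegaVec_castSucc hc hD.2.1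
  -- A solution of D₂(t) yields a point of `Os`; nonnegativity there says that the optimal value `z`
  -- is at most 0.
  have hmem := hsub (hA.mem (fun i => w i.castSucc) (p.b ⬝ᵥ u)
    (by rw [e]; exact nonneg_of_feasibleD2 h hD)
    (by rw [e]; exact fun x hx => le_of_feasibleD2 hD hx))
  rw [Set.mem_ofPred_eq, coupling_snoc, e, dotProduct_comm] at hmem
  exact ⟨x, hP.1, eq_image_of_vertex_of_feasibleP2 h hA.primal ht hP (by linarith)⟩

theorem DualApprox.cut (h : p.Admissible R Y Z c) {Os Ts O : Set (Fin (d + 1) → ℝ)}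
    (hA : DualApprox p R c Os Ts O) {a : Fin d → ℝ} (ha : ∀ v ∈ R, 0 ≤ omegaVec c a ⬝ᵥ v)
    {x : Fin n → ℝ} (hx : p.IsOptimalP1 (omegaVec c a) x) :
    DualApprox p R c (Os ∩ {ys | 0 ≤ coupling c (p.P *ᵥ x) ys}) Ts
      (O ∩ {y | omegaVec c a ⬝ᵥ p.P *ᵥ x ≤ omegaVec c a ⬝ᵥ y}) where
  primal := assumptionO_inter h hA.primal ha hx.2
  isPolyhedron := by
    rw [setOf_coupling_nonneg]
    exact hA.isPolyhedron.inter_halfspace _ _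
  nonneg := fun ys hys => hA.nonneg ys hys.1
  mem := fun a' β h1 h2 => ⟨hA.mem a' β h1 h2, by
    rw [Set.mem_ofPred_eq, coupling_snoc]
    exact sub_nonneg.2 (h2 x hx.1)⟩
  marked := fun ts hts y hy => hA.marked ts hts y hy.1

/-- The simultaneous cut of `O` by `wᵀy ≥ wᵀPx ≥ τ` makes the coupling with the marked point
nonnegative on `O`, so that point can never again give a negative minimum. -/
theorem DualApprox.mark (h : p.Admissible R Y Z c) {Os Ts O : Set (Fin (d + 1) → ℝ)}
    (hA : DualApprox p R c Os Ts O) {a : Fin d → ℝ} (ha : ∀ v ∈ R, 0 ≤ omegaVec c a ⬝ᵥ v)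
    {x : Fin n → ℝ} (hx : p.IsOptimalP1 (omegaVec c a) x) {τ : ℝ}
    (hτ : τ ≤ omegaVec c a ⬝ᵥ p.P *ᵥ x) :
    DualApprox p R c Os (Ts ∪ {Fin.snoc (α := fun _ => ℝ) a τ})
      (O ∩ {y | omegaVec c a ⬝ᵥ p.P *ᵥ x ≤ omegaVec c a ⬝ᵥ y}) where
  primal := assumptionO_inter h hA.primal ha hx.2
  isPolyhedron := hA.isPolyhedron
  nonneg := hA.nonneg
  mem := hA.mem
  marked := by
    rintro ts (hts | rfl) y hy
    · exact hA.marked ts hts y hy.1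
    · rw [coupling_snoc]
      exact sub_nonneg.2 (hτ.trans hy.2)

/-- The products of `c` with the columns are nonnegative; if their sum vanished, each would, and
`-c` would lie in `R`. -/
theorem dotProduct_sum_columns_ne_zero [Fintype κ] (h : p.Admissible R Y Z c) :
    c ⬝ᵥ ∑ j, Zᵀ j ≠ 0 := by
  intro h0
  apply h.neg_notMem
  have hcR := interior_subset h.mem_interior
  rw [h.ineq] at hcR ⊢
  change c ⬝ᵥ (∑ j, (fun i => Z i j : Fin (d + 1) → ℝ)) = 0 at h0
  rw [dotProduct_sum] at h0
  have hz := (Finset.sum_eq_zero_iff_of_nonneg fun j _ => by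
    rw [dotProduct_comm]; exact hcR j).1 h0
  intro j
  change 0 ≤ (fun i => Z i j) ⬝ᵥ -c
  rw [dotProduct_neg, dotProduct_comm, hz j (Finset.mem_univ j), neg_zero]

theorem nonneg_of_sum_columns [Fintype κ] (h : p.Admissible R Y Z c) {v : Fin (d + 1) → ℝ}
    (hv : v ∈ R) : 0 ≤ (∑ j, Zᵀ j) ⬝ᵥ v := by
  rw [h.ineq] at hv
  change 0 ≤ (∑ j, (fun i => Z i j : Fin (d + 1) → ℝ)) ⬝ᵥ v
  rw [sum_dotProduct]
  exact Finset.sum_nonneg fun j _ => hv j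

theorem DualApprox.initial (h : p.Admissible R Y Z c) {O : Set (Fin (d + 1) → ℝ)}
    (hO : p.AssumptionO R O) :
    DualApprox p R c {ys | ∀ j, 0 ≤ Yᵀ j ⬝ᵥ omegaVec c (fun i => ys i.castSucc)} ∅ O where
  primal := hO
  isPolyhedron := by
    convert isPolyhedron_setOf_forall (fun j => dotFunctional (couplingVec c (Yᵀ j) 0))
      (fun j => -Yᵀ j (Fin.last d)) using 1
    ext ys
    refine forall_congr' fun j => ?_
    rw [dotProduct_comm, omegaVec_dotProduct, dotFunctional_apply, neg_le_iff_add_nonneg']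
  nonneg := fun ys hys => by
    rw [h.gen]
    exact nonneg_on_generatedCone_iff.2 hys
  mem := fun a β ha _ j => by
    simp only [Fin.snoc_castSucc]
    rw [dotProduct_comm]
    exact ha _ (h.gen ▸ transpose_mem_generatedCone Y j)
  marked := fun _ h => h.elim

/-- The invariant of the current point `t* = (a, τ)` of the dual algorithm. -/
structure CurrentPoint (R : Set (Fin (d + 1) → ℝ)) (c : Fin (d + 1) → ℝ)
    (Os Ts : Set (Fin (d + 1) → ℝ)) (a : Fin d → ℝ) (τ : WithTop ℝ) : Prop where
  nonneg : ∀ v ∈ R, 0 ≤ omegaVec c a ⬝ᵥ v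
  exists_mem : ∀ y : ℝ, (y : WithTop ℝ) < τ → ∃ τ' > y, Fin.snoc (α := fun _ => ℝ) a τ' ∈ Os
  vertex : ∀ τ' : ℝ, τ = τ' → HasCut c Os ∧
    Fin.snoc (α := fun _ => ℝ) a τ' ∈ Os.extremePoints ℝ \ Ts

/-- The invariant of the dual algorithm. -/
def dualInvariant (p : QCP m n (d + 1)) (R : Set (Fin (d + 1) → ℝ)) (c : Fin (d + 1) → ℝ) :
    DualState n d → Prop
  | .start O => p.AssumptionO R O
  | .loop Os Ts O a τ => DualApprox p R c Os Ts O ∧ CurrentPoint R c Os Ts a τ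
  | .solved Os Ts O a τ x => DualApprox p R c Os Ts O ∧ CurrentPoint R c Os Ts a τ ∧
      p.IsOptimalP1 (omegaVec c a) x
  | .updated Os Ts O => DualApprox p R c Os Ts O ∧ HasCut c Os
  | .chosen Os Ts O t => DualApprox p R c Os Ts O ∧ HasCut c Os ∧ t ∈ O.extremePoints ℝ ∧
      ∀ s ∈ O.extremePoints ℝ, p.f t ≤ p.f s
  | .halt x => p.IsOptimal x

/-- The rank that decreases in each step of the dual algorithm. -/
noncomputable def dualRank (p : QCP m n (d + 1)) (c : Fin (d + 1) → ℝ) :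
    DualState n d → ℕ ×ₗ ℕ
  | .start _ => toLex ((Set.univ : Set (Set (Fin m))).ncard + 1, 0)
  | .loop Os Ts _ _ _ =>
      toLex ((unusedActiveSets p c Os).ncard, 4 * (Os.extremePoints ℝ \ Ts).ncard + 2)
  | .solved Os Ts _ _ _ _ =>
      toLex ((unusedActiveSets p c Os).ncard, 4 * (Os.extremePoints ℝ \ Ts).ncard + 1)
  | .updated Os Ts _ =>
      toLex ((unusedActiveSets p c Os).ncard, 4 * (Os.extremePoints ℝ \ Ts).ncard + 4)
  | .chosen Os Ts _ _ =>
      toLex ((unusedActiveSets p c Os).ncard, 4 * (Os.extremePoints ℝ \ Ts).ncard + 3)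
  | .halt _ => toLex (0, 0)

/-- A cut may create many new vertices but uses a new active set, lowering the first component of
the rank. A marking keeps `Os` and uses up a vertex. -/
theorem dual_step (h : p.Admissible R Y Z c) (hc : c (Fin.last d) = 1) [Fintype κ]
    {s s' : DualState n d} (hI : dualInvariant p R c s) (hs : DualStep p Y Z c s s') :
    dualInvariant p R c s' ∧ dualRank p c s' < dualRank p c s := by
  rcases hs with ⟨O, w, hw, hcw⟩ | ⟨Os, Ts, O, a, τ, x, hx⟩ | ⟨Os, Ts, O, a, τ, x, hτ⟩ |
    ⟨Os, Ts, O, a, τ, x, hτ⟩ | ⟨Os, Ts, O, V, t, hV, ht, hmin⟩ |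
    ⟨Os, Ts, O, t, Vs, μ, ts, hVs, hμ, hneg, hmem, hnew, hmin⟩ |
    ⟨Os, Ts, O, t, Vs, μ, x, hVs, hμ, hnn, hx, hxt⟩
  · have e : omegaVec c (fun i => (c ⬝ᵥ w)⁻¹ * w i.castSucc) = (c ⬝ᵥ w)⁻¹ • w :=
      omegaVec_castSucc hc (w := (c ⬝ᵥ w)⁻¹ • w) (by
        rw [dotProduct_smul, smul_eq_mul, inv_mul_cancel₀ hcw])
    have hnn : ∀ v ∈ R, 0 ≤ omegaVec c (fun i => (c ⬝ᵥ w)⁻¹ * w i.castSucc) ⬝ᵥ v := by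
      intro v hv
      rw [e, smul_dotProduct, hw]
      refine smul_nonneg (inv_nonneg.2 ?_) (nonneg_of_sum_columns h hv)
      rw [dotProduct_comm]
      exact nonneg_of_sum_columns h (interior_subset h.mem_interior)
    refine ⟨⟨.initial h hI, hnn, fun y _ => ⟨y + 1, lt_add_one y, fun j => ?_⟩,
      fun τ' h => (WithTop.top_ne_coe h).elim⟩, Prod.Lex.toLex_lt_toLex.2 (Or.inl ?_)⟩
    · simp only [Fin.snoc_castSucc]
      rw [dotProduct_comm]
      exact hnn _ (h.gen ▸ transpose_mem_generatedCone Y j)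
    · exact Nat.lt_succ_of_le (Set.ncard_le_ncard (Set.subset_univ _))
  · exact ⟨⟨hI.1, hI.2, hx⟩, Prod.Lex.toLex_lt_toLex.2 (Or.inr ⟨rfl, by omega⟩)⟩
  · obtain ⟨hA, hcur, hx⟩ := hI
    -- As `τ` may be `∞`, a finite height above the optimal value is chosen at which the point is
    -- still in `Os`.
    obtain ⟨τ', hτ', hm⟩ := hcur.exists_mem _ hτ
    exact ⟨⟨hA.cut h hcur.nonneg hx, p.P *ᵥ x, fun ys hys => hys.2⟩,
      Prod.Lex.toLex_lt_toLex.2 (Or.inl (Set.ncard_lt_ncard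
        (unusedActiveSets_cut_ssubset h.feasible_nonempty h.bounded hcur.nonneg hx hτ' hm)))⟩
  · obtain ⟨hA, hcur, hx⟩ := hI
    obtain ⟨hcut, hv⟩ := hcur.vertex τ rfl
    refine ⟨⟨hA.mark h hcur.nonneg hx hτ, hcut⟩, Prod.Lex.toLex_lt_toLex.2 (Or.inr ⟨rfl, ?_⟩)⟩
    -- The factor 4 in the rank lets one lost vertex pay for the jump of the offset from 1 back to
    -- 4.
    have : (Os.extremePoints ℝ \ (Ts ∪ {Fin.snoc (α := fun _ => ℝ) a τ})).ncard <
        (Os.extremePoints ℝ \ Ts).ncard := by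
      refine Set.ncard_lt_ncard ?_ (hA.isPolyhedron.finite_extremePoints.subset Set.sdiff_subset)
      rw [Set.ssubset_iff_of_subset (Set.sdiff_subset_sdiff_right Set.subset_union_left)]
      exact ⟨_, hv, fun h => h.2 (Or.inr rfl)⟩
    simp only
    omega
  · refine ⟨⟨hI.1, hI.2, hV ▸ ht, ?_⟩, Prod.Lex.toLex_lt_toLex.2 (Or.inr ⟨rfl, by simp only; omega⟩)⟩
    rw [← hV]
    exact hmin
  · obtain ⟨hA, hcut, -⟩ := hI
    have hv : ts ∈ Os.extremePoints ℝ := hVs ▸ hmem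
    refine ⟨⟨hA, hA.nonneg ts hv.1, fun y hy => ⟨_, WithTop.coe_lt_coe.1 hy, ?_⟩,
      fun τ' h => ⟨hcut, ?_⟩⟩, Prod.Lex.toLex_lt_toLex.2 (Or.inr ⟨rfl, by simp only; omega⟩)⟩
    · rw [snoc_castSucc_last]
      exact hv.1
    · rw [← WithTop.coe_inj.1 h, snoc_castSucc_last]
      exact ⟨hv, hnew⟩
  · obtain ⟨hA, hcut, ht, hmin⟩ := hI
    refine ⟨⟨hx, fun v hv => ?_⟩, Prod.Lex.toLex_lt_toLex.2 ?_⟩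
    · rw [← hxt]
      exact le_of_minimal_vertex h hA.primal hmin hv
    · rcases Nat.eq_zero_or_pos (unusedActiveSets p c Os).ncard with h0 | h0
      · exact Or.inr ⟨h0.symm, Nat.succ_pos _⟩
      · exact Or.inl h0

theorem dual_progress (h : p.Admissible R Y Z c) (hc : c (Fin.last d) = 1) [Fintype κ]
    (s : DualState n d) (hI : dualInvariant p R c s) :
    (∃ x, s = .halt x) ∨ ∃ s', DualStep p Y Z c s s' := by
  rcases s with O | ⟨Os, Ts, O, a, τ⟩ | ⟨Os, Ts, O, a, τ, x⟩ | ⟨Os, Ts, O⟩ | ⟨Os, Ts, O, t⟩ | x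
  · exact Or.inr ⟨_, .setup O _ rfl (dotProduct_sum_columns_ne_zero h)⟩
  · obtain ⟨x, u, hx, -⟩ := exists_solution_P1 h.feasible_nonempty h.bounded hI.2.nonneg
    exact Or.inr ⟨_, .solve Os Ts O a τ x hx⟩
  · induction τ using WithTop.recTopCoe with
    | top => exact Or.inr ⟨_, .cut Os Ts O a ⊤ x (WithTop.coe_lt_top _)⟩
    | coe τ =>
      rcases lt_or_ge (omegaVec c a ⬝ᵥ p.P *ᵥ x) τ with hτ | hτ
      · exact Or.inr ⟨_, .cut Os Ts O a τ x (WithTop.coe_lt_coe.2 hτ)⟩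
      · exact Or.inr ⟨_, .mark Os Ts O a τ x hτ⟩
  · obtain ⟨V, t, hV, ht, hmin⟩ := exists_minimal_vertex h hI.1.primal
    exact Or.inr ⟨_, .choose Os Ts O V t hV ht hmin⟩
  · obtain ⟨hA, hcut, ht, hmin⟩ := hI
    have hne := dual_nonempty h hc hA
    have hfin := hA.isPolyhedron.finite_extremePoints
    have hVs := hfin.coe_toFinset
    obtain ⟨v, hv⟩ :=
      hA.isPolyhedron.nonempty_extremePoints hne (line_free_of_hasCut h hc hA hcut hne)
    obtain ⟨ts, hts, htmin⟩ := Finset.exists_min_image hfin.toFinset (coupling c t)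
      ⟨v, hfin.mem_toFinset.2 hv⟩
    have hμ : IsLeast {r | ∃ ys ∈ hfin.toFinset, r = coupling c t ys} (coupling c t ts) := by
      refine ⟨⟨ts, hts, rfl⟩, ?_⟩
      rintro _ ⟨ys, hys, rfl⟩
      exact htmin ys hys
    by_cases hneg : coupling c t ts < 0
    -- Marked points couple nonnegatively with `t ∈ O`, so a minimizer with negative value is
    -- unmarked and also minimizes over the unmarked vertices.
    · exact Or.inr ⟨_, .next Os Ts O t hfin.toFinset _ ts hVs hμ hneg hts
        (fun hT => hneg.not_ge (hA.marked ts hT t ht.1)) fun ys hys _ => htmin ys hys⟩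
    · obtain ⟨x, hx, hxt⟩ := exists_eq_image_of_coupling_nonneg h hc hA hcut ht fun ys hys =>
        (not_lt.1 hneg).trans (htmin ys (hfin.mem_toFinset.2 hys))
      exact Or.inr ⟨_, .finish Os Ts O t hfin.toFinset _ x hVs hμ hneg hx hxt⟩
  · exact Or.inl ⟨x, rfl⟩

theorem dual_correctAndFinite (h : p.Admissible R Y Z c) (hc : c (Fin.last d) = 1) [Fintype κ]
    {O : Set (Fin (d + 1) → ℝ)} (hO : p.AssumptionO R O) :
    CorrectAndFinite (DualStep p Y Z c) (.start O) DualState.halt p.IsOptimal :=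
  correctAndFinite_of_rank (dualInvariant p R c) (dualRank p c) hO
    (fun _ _ hI hs => dual_step h hc hI hs) (dual_progress h hc) fun _ hx => hx

end Dual

end QCP

/-! ### The cone `R` and the reformulated problem. -/

section Reformulation

variable {m n q o : ℕ}

theorem appendNegRowSum_mulVec_castSucc {ι : Type*} [Fintype ι] (M : Matrix (Fin q) ι ℝ)
    (x : ι → ℝ) (i : Fin q) : (appendNegRowSum M *ᵥ x) i.castSucc = (M *ᵥ x) i := by
  simp [appendNegRowSum, mulVec, dotProduct]

theorem appendNegRowSum_mulVec_last {ι : Type*} [Fintype ι] (M : Matrix (Fin q) ι ℝ)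
    (x : ι → ℝ) : (appendNegRowSum M *ᵥ x) (Fin.last q) = -∑ i, (M *ᵥ x) i := by
  simp only [appendNegRowSum, mulVec, dotProduct, Matrix.of_apply, Fin.snoc_last, neg_mul,
    Finset.sum_neg_distrib, Finset.sum_mul]
  rw [Finset.sum_comm]

/-- The sum of all components, `eᵀy + η`. -/
def coordSum (y : Fin (q + 1) → ℝ) : ℝ := (∑ i : Fin q, y i.castSucc) + y (Fin.last q)

theorem coordSum_add (x y : Fin (q + 1) → ℝ) : coordSum (x + y) = coordSum x + coordSum y := by
  simp only [coordSum, Pi.add_apply, Finset.sum_add_distrib]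
  ring

theorem coordSum_smul (s : ℝ) (x : Fin (q + 1) → ℝ) : coordSum (s • x) = s * coordSum x := by
  simp only [coordSum, Pi.smul_apply, smul_eq_mul, mul_add, Finset.mul_sum]

theorem coordSum_appendNegRowSum {ι : Type*} [Fintype ι] (M : Matrix (Fin q) ι ℝ) (x : ι → ℝ) :
    coordSum (appendNegRowSum M *ᵥ x) = 0 := by
  simp only [coordSum, appendNegRowSum_mulVec_castSucc, appendNegRowSum_mulVec_last,
    add_neg_cancel]

theorem mem_extendedCone {Y : Matrix (Fin q) (Fin o) ℝ} {y : Fin (q + 1) → ℝ} :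
    y ∈ generatedCone (extendedGenerators Y) ↔
      ∃ α μ, 0 ≤ α ∧ 0 ≤ μ ∧ y = α + appendNegRowSum Y *ᵥ μ := by
  constructor
  · rintro ⟨ν, hν, rfl⟩
    refine ⟨ν ∘ Sum.inl, ν ∘ Sum.inr, fun i => hν _, fun i => hν _, ?_⟩
    rw [extendedGenerators, fromCols_mulVec, one_mulVec]
  · rintro ⟨α, μ, hα, hμ, rfl⟩
    refine ⟨Sum.elim α μ, fun i => ?_, ?_⟩
    · cases i
      · exact hα _
      · exact hμ _
    · rw [extendedGenerators, fromCols_mulVec, one_mulVec, Sum.elim_comp_inl, Sum.elim_comp_inr]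

theorem coordSum_nonneg_of_nonneg {α : Fin (q + 1) → ℝ} (hα : 0 ≤ α) : 0 ≤ coordSum α :=
  add_nonneg (Finset.sum_nonneg fun _ _ => hα _) (hα _)

theorem eq_zero_of_coordSum_nonpos {α : Fin (q + 1) → ℝ} (hα : 0 ≤ α) (h : coordSum α ≤ 0) :
    α = 0 := by
  have h1 : 0 ≤ ∑ i : Fin q, α i.castSucc := Finset.sum_nonneg fun _ _ => hα _
  have h2 : 0 ≤ α (Fin.last q) := hα _
  have h3 : (∑ i : Fin q, α i.castSucc) + α (Fin.last q) ≤ 0 := h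
  have h4 : ∑ i : Fin q, α i.castSucc = 0 := by linarith
  rw [Finset.sum_eq_zero_iff_of_nonneg fun i _ => hα (Fin.castSucc i)] at h4
  funext i
  refine Fin.lastCases ?_ (fun i => h4 i (Finset.mem_univ _)) i
  change α (Fin.last q) = 0
  linarith

theorem coordSum_nonneg_of_mem {Y : Matrix (Fin q) (Fin o) ℝ} {y : Fin (q + 1) → ℝ}
    (hy : y ∈ generatedCone (extendedGenerators Y)) : 0 ≤ coordSum y := by
  obtain ⟨α, μ, hα, -, rfl⟩ := mem_extendedCone.1 hy
  rw [coordSum_add, coordSum_appendNegRowSum, add_zero]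
  exact coordSum_nonneg_of_nonneg hα

/-- Only the orthant part contributes to `coordSum`. This identifies the face of `R` where it
vanishes with a copy of `C`. -/
theorem eq_appendNegRowSum_of_coordSum_nonpos {Y : Matrix (Fin q) (Fin o) ℝ}
    {y : Fin (q + 1) → ℝ} (hy : y ∈ generatedCone (extendedGenerators Y)) (h0 : coordSum y ≤ 0) :
    ∃ μ, 0 ≤ μ ∧ y = appendNegRowSum Y *ᵥ μ := by
  obtain ⟨α, μ, hα, hμ, rfl⟩ := mem_extendedCone.1 hy
  rw [coordSum_add, coordSum_appendNegRowSum, add_zero] at h0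
  exact ⟨μ, hμ, by rw [eq_zero_of_coordSum_nonpos hα h0, zero_add]⟩

theorem castSucc_mem_of_eq_appendNegRowSum {Y : Matrix (Fin q) (Fin o) ℝ} {y : Fin (q + 1) → ℝ}
    {μ : Fin o → ℝ} (hμ : 0 ≤ μ) (hy : y = appendNegRowSum Y *ᵥ μ) :
    (fun i : Fin q => y i.castSucc) ∈ generatedCone Y :=
  ⟨μ, hμ, by funext i; rw [hy, appendNegRowSum_mulVec_castSucc]⟩

/-- `R` is pointed when `C` is. -/
theorem isPointedCone_extended {Y : Matrix (Fin q) (Fin o) ℝ}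
    (h : IsPointedCone (generatedCone Y)) :
    IsPointedCone (generatedCone (extendedGenerators Y)) := by
  refine Set.Subset.antisymm ?_ ?_
  · rintro y ⟨hy, hy'⟩
    have h1 := coordSum_nonneg_of_mem hy
    have h2 := coordSum_nonneg_of_mem hy'
    have h3 : coordSum (-y) = -coordSum y := by
      rw [← neg_one_smul ℝ y, coordSum_smul, neg_one_mul]
    obtain ⟨μ, hμ, he⟩ := eq_appendNegRowSum_of_coordSum_nonpos hy (by linarith)
    obtain ⟨μ', hμ', he'⟩ := eq_appendNegRowSum_of_coordSum_nonpos hy' (by linarith)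
    have hz : (fun i : Fin q => y i.castSucc) ∈ generatedCone Y ∩ {y | -y ∈ generatedCone Y} :=
      ⟨castSucc_mem_of_eq_appendNegRowSum hμ he, castSucc_mem_of_eq_appendNegRowSum hμ' he'⟩
    rw [h, Set.mem_singleton_iff] at hz
    have hz' : ∀ i : Fin q, y i.castSucc = 0 := congrFun hz
    rw [Set.mem_singleton_iff]
    funext i
    refine Fin.lastCases ?_ hz' i
    have : coordSum y = 0 := by linarith
    simpa [coordSum, hz'] using this
  · rintro _ rfl
    exact ⟨zero_mem_generatedCone _, by
      simpa using zero_mem_generatedCone (extendedGenerators Y)⟩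

theorem one_mem_interior_extended (Y : Matrix (Fin q) (Fin o) ℝ) :
    (1 : Fin (q + 1) → ℝ) ∈ interior (generatedCone (extendedGenerators Y)) := by
  refine mem_interior.2 ⟨Set.univ.pi fun _ => Set.Ioi 0, fun y hy => ?_,
    isOpen_set_pi Set.finite_univ fun _ _ => isOpen_Ioi, fun i _ => Set.mem_Ioi.2 one_pos⟩
  -- The identity columns place the whole open positive orthant in `R`.
  exact mem_extendedCone.2 ⟨y, 0, fun i => (hy i trivial).le, le_rfl, by simp⟩

theorem extendedObjective_apply (f : (Fin q → ℝ) → EReal) (y : Fin (q + 1) → ℝ) :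
    extendedObjective f y = if 0 ≤ coordSum y then f (fun i => y i.castSucc) else ⊥ := by
  rw [extendedObjective, coordSum]

/-- Above a level `r ≠ ⊥` the superlevel set is a half-space intersected with the cylinder over a
superlevel set of `f`. -/
theorem quasiconcaveOn_extendedObjective {f : (Fin q → ℝ) → EReal}
    (hf : QuasiconcaveOn ℝ Set.univ f) : QuasiconcaveOn ℝ Set.univ (extendedObjective f) := by
  intro r
  rcases eq_or_ne r ⊥ with rfl | hr
  · simpa using convex_univ
  · have key : ∀ y, r ≤ extendedObjective f y ↔
        0 ≤ coordSum y ∧ r ≤ f (fun i => y i.castSucc) := by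
      intro y
      rw [extendedObjective_apply]
      split_ifs with h
      · simp [h]
      · simp [h, hr]
    rintro x ⟨-, hx⟩ y ⟨-, hy⟩ a b ha hb hab
    refine ⟨trivial, ?_⟩
    rw [key] at hx hy ⊢
    refine ⟨?_, (hf r ⟨trivial, hx.2⟩ ⟨trivial, hy.2⟩ ha hb hab).2⟩
    rw [coordSum_add, coordSum_smul, coordSum_smul]
    exact add_nonneg (mul_nonneg ha hx.1) (mul_nonneg hb hy.1)

namespace QCP

theorem reformulated_image_castSucc (p : QCP m n q) (x : Fin n → ℝ) :
    (fun i : Fin q => (p.reformulated.P *ᵥ x) i.castSucc) = p.P *ᵥ x :=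
  funext fun i => appendNegRowSum_mulVec_castSucc p.P x i

theorem reformulated_objective (p : QCP m n q) (x : Fin n → ℝ) :
    p.reformulated.f (p.reformulated.P *ᵥ x) = p.f (p.P *ᵥ x) := by
  have h : coordSum (p.reformulated.P *ᵥ x) = 0 := coordSum_appendNegRowSum p.P x
  change extendedObjective p.f _ = _
  rw [extendedObjective_apply, if_pos h.ge, reformulated_image_castSucc]

theorem reformulated_isOptimal_iff (p : QCP m n q) (x : Fin n → ℝ) :
    p.reformulated.IsOptimal x ↔ p.IsOptimal x := by
  simp only [IsOptimal, reformulated_objective]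
  rfl

/-- On P̄[S] - R, `coordSum` is at most 0, and it grows along `R`. If it is negative at the smaller
point, the value there is `⊥`; otherwise it is 0 at both points, all cone elements involved lie on
the face over `C`, and monotonicity of `f` applies. -/
theorem reformulated_assumptionM {p : QCP m n q} {Y : Matrix (Fin q) (Fin o) ℝ}
    (hM : p.AssumptionM (generatedCone Y)) :
    p.reformulated.AssumptionM (generatedCone (extendedGenerators Y)) := by
  have sum_nonpos : ∀ {x : Fin n → ℝ} {e : Fin (q + 1) → ℝ},
      coordSum (p.reformulated.P *ᵥ x - e) = -coordSum e := by
    intro x e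
    have h : coordSum (p.reformulated.P *ᵥ x) = 0 := coordSum_appendNegRowSum p.P x
    rw [sub_eq_add_neg, ← neg_one_smul ℝ e, coordSum_add, coordSum_smul, h, zero_add, neg_one_mul]
  have mem : ∀ {x : Fin n → ℝ} {e : Fin (q + 1) → ℝ}, x ∈ p.feasible →
      e ∈ generatedCone (extendedGenerators Y) → coordSum e ≤ 0 →
      (fun i : Fin q => (p.reformulated.P *ᵥ x - e) i.castSucc) ∈
        {y | ∃ v ∈ p.image, ∃ d ∈ generatedCone Y, y = v - d} := by
    intro x e hx he h0
    obtain ⟨μ, hμ, he'⟩ := eq_appendNegRowSum_of_coordSum_nonpos he h0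
    refine ⟨_, ⟨x, hx, rfl⟩, _, castSucc_mem_of_eq_appendNegRowSum hμ he', ?_⟩
    rw [← p.reformulated_image_castSucc]
    rfl
  rintro _ ⟨_, ⟨x, hx, rfl⟩, e, he, rfl⟩ _ ⟨_, ⟨x', hx', rfl⟩, e', he', rfl⟩ hd
  change extendedObjective p.f _ ≤ extendedObjective p.f _
  have h1 := coordSum_nonneg_of_mem he'
  have h2 := coordSum_nonneg_of_mem hd
  have h3 : coordSum (p.reformulated.P *ᵥ x' - e') = coordSum (p.reformulated.P *ᵥ x - e) +
      coordSum (p.reformulated.P *ᵥ x' - e' - (p.reformulated.P *ᵥ x - e)) := by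
    rw [← coordSum_add, add_sub_cancel]
  rw [extendedObjective_apply]
  split_ifs with h0
  · have h4 := coordSum_nonneg_of_mem he
    have e1 := sum_nonpos (x := x) (e := e)
    have e2 := sum_nonpos (x := x') (e := e')
    rw [extendedObjective_apply, if_pos (by linarith)]
    obtain ⟨μ, hμ, hμe⟩ := eq_appendNegRowSum_of_coordSum_nonpos hd (by linarith)
    exact hM _ (mem hx he (by linarith)) _ (mem hx' he' (by linarith))
      (castSucc_mem_of_eq_appendNegRowSum hμ hμe)
  · exact bot_le

/-- A recession direction of P̄[S] projects to one of P[S], hence into `C`; `coordSum` vanishes on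
it, which fixes its last coordinate. -/
theorem reformulated_assumptionB {p : QCP m n q} {Y : Matrix (Fin q) (Fin o) ℝ}
    (hS : p.feasible.Nonempty) (hB : p.AssumptionB (generatedCone Y)) :
    p.reformulated.AssumptionB (generatedCone (extendedGenerators Y)) := by
  intro e he
  have key : ∀ x ∈ p.feasible, ∀ s : ℝ, 0 ≤ s → ∃ v ∈ p.feasible,
      p.reformulated.P *ᵥ x + s • e = p.reformulated.P *ᵥ v :=
    fun x hx s hs => he _ ⟨x, hx, rfl⟩ s hs
  obtain ⟨μ, hμ, heμ⟩ : (fun i : Fin q => e i.castSucc) ∈ generatedCone Y := by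
    refine hB ?_
    rintro _ ⟨x, hx, rfl⟩ s hs
    obtain ⟨v, hv, hve⟩ := key x hx s hs
    refine ⟨v, hv, ?_⟩
    rw [← p.reformulated_image_castSucc, ← p.reformulated_image_castSucc, ← hve]
    rfl
  have h0 : coordSum e = 0 := by
    obtain ⟨x, hx⟩ := hS
    obtain ⟨v, -, hve⟩ := key x hx 1 zero_le_one
    have h1 : coordSum (p.reformulated.P *ᵥ x) = 0 := coordSum_appendNegRowSum p.P x
    have h2 : coordSum (p.reformulated.P *ᵥ v) = 0 := coordSum_appendNegRowSum p.P v
    rwa [← hve, coordSum_add, h1, zero_add, one_smul] at h2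
  have hi : ∀ i : Fin q, e i.castSucc = (Y *ᵥ μ) i := congrFun heμ
  refine mem_extendedCone.2 ⟨0, μ, le_rfl, hμ, ?_⟩
  rw [zero_add]
  funext i
  refine Fin.lastCases ?_ (fun i => ?_) i
  · rw [appendNegRowSum_mulVec_last, eq_neg_iff_add_eq_zero, add_comm]
    simpa only [coordSum, hi] using h0
  · rw [appendNegRowSum_mulVec_castSucc, hi]

end QCP

/-! ### Existence of the inputs. -/

/-- A finitely generated cone has an inequality description. -/
theorem exists_eq_inequalityCone {k : ℕ} {ι : Type*} [Fintype ι] (Y : Matrix (Fin k) ι ℝ) :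
    ∃ (r : ℕ) (Z : Matrix (Fin k) (Fin r) ℝ), generatedCone Y = inequalityCone Z := by
  obtain ⟨T, hT⟩ := exists_functionals_of_fg (fun j => Yᵀ j : ι → Fin k → ℝ) Finset.univ
  choose w hw using fun l : (Fin k → ℝ) →ₗ[ℝ] ℝ => exists_eq_dotFunctional l
  refine ⟨T.card, Matrix.of fun i j => w (T.equivFin.symm j).1 i, ?_⟩
  have e : ∀ l y, w l ⬝ᵥ y = l y := fun l y => by
    conv_rhs => rw [hw l]
    rfl
  ext y
  have h1 : y ∈ generatedCone Y ↔ ∃ μ : ι → ℝ, 0 ≤ μ ∧ ∑ j, μ j • (fun i => Y i j) = y := by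
    refine exists_congr fun μ => and_congr Iff.rfl ?_
    rw [eq_comm, mulVec_eq_sum]
    simp only [op_smul_eq_smul]
    rfl
  refine h1.trans ((hT y).trans ?_)
  constructor
  · intro h j
    exact (h _ (T.equivFin.symm j).2).trans_eq (e _ _).symm
  · intro h l hl
    have := h (T.equivFin ⟨l, hl⟩)
    simp only [mulVec, transpose, Matrix.of_apply, Equiv.symm_apply_apply, e] at this
    exact this

/-- An outer approximation exists for every feasible and `R`-bounded problem. -/
theorem QCP.exists_assumptionO {k : ℕ} {κ : Type*} [Finite κ] (p : QCP m n k)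
    (hS : p.feasible.Nonempty) {Z : Matrix (Fin k) κ ℝ} (hB : p.AssumptionB (inequalityCone Z)) :
    ∃ O, p.AssumptionO (inequalityCone Z) O := by
  -- One supporting half-space of P[S] for each column of `Z`; the minimum is attained since the
  -- column is nonnegative on the cone.
  choose x u hx _ _ _ using fun j => exists_solution_P1 hS hB (w := fun i => Z i j)
    fun d hd => hd j
  set O : Set (Fin k → ℝ) :=
    {y | ∀ j, dotFunctional (fun i => Z i j) (p.P *ᵥ x j) ≤ dotFunctional (fun i => Z i j) y}
    with hO
  have hpoly : IsPolyhedron O := isPolyhedron_setOf_forall _ _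
  have hsub : p.upperImage (inequalityCone Z) ⊆ O := by
    rintro _ ⟨_, ⟨v, hv, rfl⟩, d, hd, rfl⟩ j
    rw [map_add]
    exact le_add_of_le_of_nonneg ((hx j).2 v hv) (hd j)
  refine ⟨O, hpoly, hsub, Set.Subset.antisymm (fun d hd j => ?_) fun d hd y hy s hs j => ?_⟩
  · obtain ⟨v, hv⟩ := hS
    have hvO : p.P *ᵥ v ∈ O := hsub ⟨_, ⟨v, hv, rfl⟩, 0, fun j => by simp, (add_zero _).symm⟩
    refine nonneg_of_forall_nonneg_add (a := dotFunctional (fun i => Z i j) (p.P *ᵥ v) -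
      dotFunctional (fun i => Z i j) (p.P *ᵥ x j)) fun s hs => ?_
    have := hd _ hvO s hs j
    rw [map_add, map_smul, smul_eq_mul] at this
    change 0 ≤ _ + s * dotFunctional (fun i => Z i j) d
    linarith
  · rw [map_add, map_smul]
    exact le_add_of_le_of_nonneg (hy j) (smul_nonneg hs (hd j))

end Reformulation

/-- Pointedness would force `c = 0`, making 0 an interior point of a pointed cone and `{0}` open,
impossible in the positive dimension `q + 1`. -/
theorem neg_notMem_of_mem_interior {q : ℕ} {R : Set (Fin (q + 1) → ℝ)} (hR : IsPointedCone R)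
    {c : Fin (q + 1) → ℝ} (hc : c ∈ interior R) : -c ∉ R := by
  intro hneg
  have h0 : c ∈ R ∩ {y | -y ∈ R} := ⟨interior_subset hc, hneg⟩
  rw [hR, Set.mem_singleton_iff] at h0
  subst h0
  have hmem : interior R ∩ -interior R ∈ nhds (0 : Fin (q + 1) → ℝ) :=
    (isOpen_interior.inter isOpen_interior.neg).mem_nhds ⟨hc, by simpa using hc⟩
  have hsub : interior R ∩ -interior R ⊆ {0} := fun y hy =>
    hR ▸ ⟨interior_subset hy.1, show -y ∈ R from interior_subset (Set.mem_neg.1 hy.2)⟩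
  have hnhds : ({0} : Set (Fin (q + 1) → ℝ)) ∈ nhds 0 := Filter.mem_of_superset hmem hsub
  exact not_isOpen_singleton (0 : Fin (q + 1) → ℝ) (isOpen_singleton_iff_nhds_eq_pure 0 |>.2
    (le_antisymm (Filter.le_pure_iff.2 hnhds) (pure_le_nhds 0)))

theorem mainTheorem5 {m n q o : ℕ} (p : QCP m n q)
    (C : Set (Fin q → ℝ)) (Y : Matrix (Fin q) (Fin o) ℝ)
    (hC : C = generatedCone Y) (hpointed : IsPointedCone C)
    (hS : p.feasible.Nonempty)
    (hf : QuasiconcaveOn ℝ Set.univ p.f)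
    (hM : p.AssumptionM C) (hB : p.AssumptionB C)
    (R : Set (Fin (q + 1) → ℝ)) (hR : R = generatedCone (extendedGenerators Y)) :
    -- the reformulated problem, with the cone `R`, is an admissible instance with `R` solid
    (IsPointedCone R ∧ (interior R).Nonempty ∧
      QuasiconcaveOn ℝ Set.univ p.reformulated.f ∧
      p.reformulated.AssumptionM R ∧ p.reformulated.AssumptionB R) ∧
    -- it has the same optimal solutions as the original problem
    (∀ x, p.reformulated.IsOptimal x ↔ p.IsOptimal x) ∧
    -- the additional input required by the algorithms exists
    ((∃ (r : ℕ) (Z : Matrix (Fin (q + 1)) (Fin r) ℝ), R = inequalityCone Z) ∧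
      (∃ c ∈ interior R, c (Fin.last q) = 1) ∧
      (∃ O, p.reformulated.AssumptionO R O)) ∧
    -- for every such input, both algorithms are correct and finite
    (∀ (r : ℕ) (Z : Matrix (Fin (q + 1)) (Fin r) ℝ) (c : Fin (q + 1) → ℝ)
      (O : Set (Fin (q + 1) → ℝ)),
      R = inequalityCone Z → c ∈ interior R → p.reformulated.AssumptionO R O →
      CorrectAndFinite (PrimalStep p.reformulated (extendedGenerators Y) Z c)
        (PrimalState.loop O) PrimalState.halt
        (fun x => p.reformulated.IsOptimal x ∧ p.IsOptimal x) ∧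
      (c (Fin.last q) = 1 →
        CorrectAndFinite (DualStep p.reformulated (extendedGenerators Y) Z c)
          (DualState.start O) DualState.halt
          (fun x => p.reformulated.IsOptimal x ∧ p.IsOptimal x))) := by
  subst hC hR
  have hRp := isPointedCone_extended hpointed
  have hq : QuasiconcaveOn ℝ Set.univ p.reformulated.f := quasiconcaveOn_extendedObjective hf
  have hM' := QCP.reformulated_assumptionM hM
  have hB' := QCP.reformulated_assumptionB hS hB
  have hone := one_mem_interior_extended Y
  have hspec : ∀ x, p.reformulated.IsOptimal x → p.reformulated.IsOptimal x ∧ p.IsOptimal x :=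
    fun x hx => ⟨hx, (p.reformulated_isOptimal_iff x).1 hx⟩
  obtain ⟨r, Z, hZ⟩ := exists_eq_inequalityCone (extendedGenerators Y)
  refine ⟨⟨hRp, ⟨_, hone⟩, hq, hM', hB'⟩, p.reformulated_isOptimal_iff,
    ⟨⟨r, Z, hZ⟩, ⟨1, hone, rfl⟩, ?_⟩, fun r Z c O hZ hc hO => ?_⟩
  · rw [hZ] at hB' ⊢
    exact p.reformulated.exists_assumptionO hS hB'
  · have hadm : p.reformulated.Admissible (generatedCone (extendedGenerators Y))
        (extendedGenerators Y) Z c :=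
      ⟨rfl, hZ, hRp, hc, neg_notMem_of_mem_interior hRp hc, hS, hq, hM', hB'⟩
    exact ⟨(QCP.primal_correctAndFinite hadm hO).mono hspec, fun hc1 =>
      (QCP.dual_correctAndFinite hadm hc1 hO).mono hspec⟩
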